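/- Let $n\ge 2$ and let $X_1,\dots,X_n$ be a random sample from the Gamma distribution with unknown shape $\alpha>0$ and rate $\lambda>0$, i.e. with density $\lambda^{\alpha}x^{\alpha-1}e^{-\lambda x}/\Gamma(\alpha)$, $x>0$. Put $X=\sum_{i=1}^n X_i$, and let $Y$ be the $n$-th power of the ratio of the geometric mean to the arithmetic mean of $X_1,\dots,X_n$. An unbiased estimator of $\alpha$ is a Borel function $T(X_1,\dots,X_n)$ with $\mathbb E_{\alpha,\lambda}|T|<\infty$ and $\mathbb E_{\alpha,\lambda}T=\alpha$ for all $\alpha,\lambda>0$; it is called a UMVUE of $\alpha$ if it is a Borel function of $(X,Y)$ (its variance is allowed to be infinite). Define $\gamma_1(0)=1$, $\gamma_1(m)=0$ for $m\ge1$, and, for $i=1,\dots,n-2$ and $m\ge0$, $$\gamma_{i+1}(m)=\frac{\Gamma\left(m+\frac{i(i+1)}{2n}\right)}{\Gamma\left(m+\frac{(i+1)(i+2)}{2n}\right)}\sum_{k=0}^m\frac{\Gamma\left(m-k+\frac{i+1}{n}\right)}{(m-k)!}\,\gamma_i(k),$$ and let $G(y)=\sum_{m=0}^\infty \gamma_{n-1}(m)(1-y)^m$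 for $0<y<1$. Then a UMVUE of $\alpha$ exists if and only if $n\ge4$. For $n\ge4$ the series $G$ converges on $(0,1)$ to a positive differentiable function, and $$u_0(Y)=\frac{n-3}{2}\cdot\frac{Y}{1-Y}-\frac{Y\,G'(Y)}{G(Y)}$$ is the UMVUE of $\alpha$: it is a UMVUE, every UMVUE of $\alpha$ equals $u_0(Y)$ almost surely under every $(\alpha,\lambda)$, and for every unbiased estimator $T$ of $\alpha$ and all $\alpha,\lambda>0$ one has $\operatorname{Var}_{\alpha,\lambda}u_0(Y)\le\operatorname{Var}_{\alpha,\lambda}T$ in $[0,\infty]$. For $n\ge4$ and all $\alpha,\lambda>0$, the variance of $u_0(Y)$ is finite if and only if $n\ge6$. For $n=2,3$ no unbiased estimator of $\alpha$ exists. -/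

import Mathlib

open MeasureTheory ProbabilityTheory

noncomputable section

namespace GammaSample

/-- Joint law of a random sample `X₁, …, Xₙ` from the Gamma distribution with shape `α` and
rate `r`. -/
def law (n : ℕ) (α r : ℝ) : Measure (Fin n → ℝ) :=
  Measure.pi fun _ => gammaMeasure α r

/-- Arithmetic mean of the data. -/
def arithMean {n : ℕ} (x : Fin n → ℝ) : ℝ := (∑ i, x i) / n

/-- Geometric mean of the data. -/
def geomMean {n : ℕ} (x : Fin n → ℝ) : ℝ := (∏ i, x i) ^ (1 / (n : ℝ))

/-- The statistic `X`: the sum of the data. -/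
def statX {n : ℕ} (x : Fin n → ℝ) : ℝ := ∑ i, x i

/-- The statistic `Y`: the `n`-th power of the ratio of the geometric to the arithmetic mean. -/
def statY {n : ℕ} (x : Fin n → ℝ) : ℝ := (geomMean x / arithMean x) ^ n

/-- The coefficients `γ_i(m)`, for `i = 1, 2, …`; the row `i = 0` is not used. The last case is
the recursion step from row `i + 1` to row `i + 2`. -/
def gammaCoeff (n : ℕ) : ℕ → ℕ → ℝ
  | 0, _ => 0
  | 1, m => if m = 0 then 1 else 0
  | i + 2, m =>
      Real.Gamma (m + ((i : ℝ) + 1) * (i + 2) / (2 * n)) /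
          Real.Gamma (m + ((i : ℝ) + 2) * (i + 3) / (2 * n)) *
        ∑ k ∈ Finset.range (m + 1),
          Real.Gamma (((m - k : ℕ) : ℝ) + ((i : ℝ) + 2) / n) / ((m - k).factorial : ℝ) *
            gammaCoeff n (i + 1) k

/-- `d_m = γ_{n-1}(m)`. -/
def d (n m : ℕ) : ℝ := gammaCoeff n (n - 1) m

/-- `G(y) = ∑_{m ≥ 0} d_m (1 - y)^m`. -/
def G (n : ℕ) (y : ℝ) : ℝ := ∑' m : ℕ, d n m * (1 - y) ^ m

/-- `u₀(y) = ((n - 3) / 2) y / (1 - y) - y G'(y) / G(y)`. -/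
def u₀ (n : ℕ) (y : ℝ) : ℝ :=
  1 / 2 * ((n : ℝ) - 3) * (y / (1 - y)) - y * deriv (G n) y / G n y

/-- `T` is an unbiased estimator of the parametric function `h(α, r)`. -/
structure IsUnbiased (n : ℕ) (h : ℝ → ℝ → ℝ) (T : (Fin n → ℝ) → ℝ) : Prop where
  measurable : Measurable T
  integrable : ∀ α r : ℝ, 0 < α → 0 < r → Integrable T (law n α r)
  integral_eq : ∀ α r : ℝ, 0 < α → 0 < r → ∫ x, T x ∂(law n α r) = h α r

/-- `T` is a UMVUE of `h(α, r)`: it is unbiased and, on the sample space `(0, ∞)ⁿ`, a Borel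
function of `(X, Y)`. The variance may be infinite. -/
structure IsUMVUE (n : ℕ) (h : ℝ → ℝ → ℝ) (T : (Fin n → ℝ) → ℝ) : Prop where
  unbiased : IsUnbiased n h T
  factors : ∃ u : ℝ × ℝ → ℝ, Measurable u ∧
    ∀ x : Fin n → ℝ, (∀ i, 0 < x i) → T x = u (statX x, statY x)

/-- The parametric function `h(α, r) = α`. -/
def shape (α _r : ℝ) : ℝ := α

end GammaSample

end

noncomputable section

namespace GammaSample

open BoundedContinuousFunction

/-! Raising the shape by a natural number k and the rate by t ≥ 0 multiplies the joint density by a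
constant times (∏ xᵢ)^k e^{-tX} (`law_tilt`). A statistic with mean zero at every parameter is
therefore orthogonal to all monomials in (∏ xᵢ)e^{-X} and e^{-X}, two bounded statistics that carry
the same information as (X, Y). Moment determinacy on the square then kills its conditional
expectation (`condExp_boundedStat_eq_zero`). So an unbiased function of (X, Y) is the conditional
expectation of every unbiased estimator, which gives uniqueness and, by contraction in L², minimal
variance.

Tilting also yields the moments of Y, which equal ∏ B(α+k, j/n) / ∏ B(α, j/n) over 1 ≤ j < n. The
recursion for γ expands ∏ B(s, j/n) as ∑ d_m B(s, m + (n-1)/2) (`tsum_d_mul_beta`), so the density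
of Y is proportional to y^{α-1} w(y) with w(y) = (1-y)^{(n-3)/2} G(y) (`law_map_statY`). Since u₀ =
-y w'/w, unbiasedness is integration by parts of α y^{α-1} w; the boundary term at 1 vanishes
because n ≥ 4. The computation is done term by term in `lintegral_u₀`. Near 1, w u₀² behaves like
(1-y)^{(n-7)/2}, integrable only for n ≥ 6; near 0, G grows slower than any negative power of y
(`exists_G_half_le`).

For n = 2, 3 an unbiased T would satisfy E[T Y^k; X ≥ ε] = (1+k) E[Y^k; X ≥ ε] at α = λ = 1. As k →
∞ the left side tends to 0, while the right side stays bounded below because E Y^k is at least of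
order 1/k (`le_succ_mul_momentY`). -/

/-! ### Moment determinacy and vanishing conditional expectations -/

/-- Finite measures on the unit square are determined by their moments. -/
theorem ext_of_moments {μ ν : Measure (ℝ × ℝ)} [IsFiniteMeasure μ] [IsFiniteMeasure ν]
    (hμ : ∀ᵐ x ∂μ, x ∈ Set.Icc (0 : ℝ × ℝ) 1) (hν : ∀ᵐ x ∂ν, x ∈ Set.Icc (0 : ℝ × ℝ) 1)
    (h : ∀ j k : ℕ, ∫ x, x.1 ^ j * x.2 ^ k ∂μ = ∫ x, x.1 ^ j * x.2 ^ k ∂ν) : μ = ν := by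
  set K : Set (ℝ × ℝ) := Set.Icc 0 1 with hK
  have hKm : MeasurableSet K := measurableSet_Icc
  have : CompactSpace K := isCompact_iff_compactSpace.1 isCompact_Icc
  have hμr : μ.restrict K = μ := Measure.restrict_eq_self_of_ae_mem hμ
  have hνr : ν.restrict K = ν := Measure.restrict_eq_self_of_ae_mem hν
  suffices H : μ.comap ((↑) : K → ℝ × ℝ) = ν.comap ((↑) : K → ℝ × ℝ) by
    rw [← hμr, ← hνr, ← map_comap_subtype_coe hKm, ← map_comap_subtype_coe hKm, H]
  have finite_comap (ρ : Measure (ℝ × ℝ)) [IsFiniteMeasure ρ] :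
      IsFiniteMeasure (ρ.comap ((↑) : K → ℝ × ℝ)) := by
    refine ⟨?_⟩
    rw [comap_subtype_coe_apply hKm]
    exact measure_lt_top _ _
  -- Polynomials in the two coordinates form a star subalgebra that separates the points of the
  -- compact square, hence determine finite measures on it.
  let f : Fin 2 → (K →ᵇ ℝ) :=
    ![mkOfCompact ⟨fun x => x.1.1, by fun_prop⟩, mkOfCompact ⟨fun x => x.1.2, by fun_prop⟩]
  let A : StarSubalgebra ℝ (K →ᵇ ℝ) :=
    { (MvPolynomial.aeval f : MvPolynomial (Fin 2) ℝ →ₐ[ℝ] (K →ᵇ ℝ)).range with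
      star_mem' := by
        intro a ha
        have : star a = a := by ext x; simp
        rw [this]; exact ha }
  have hfA : ∀ i, f i ∈ A := fun i => ⟨MvPolynomial.X i, by simp⟩
  refine ext_of_forall_mem_subalgebra_integral_eq_of_polish (𝕜 := ℝ) (A := A) ?_ ?_
  · intro x y hxy
    by_cases h1 : x.1.1 = y.1.1
    · have h2 : x.1.2 ≠ y.1.2 := fun h2 => hxy (Subtype.ext (Prod.ext h1 h2))
      exact ⟨_, ⟨_, ⟨f 1, hfA 1, rfl⟩, rfl⟩, by simpa [f] using h2⟩
    · exact ⟨_, ⟨_, ⟨f 0, hfA 0, rfl⟩, rfl⟩, by simpa [f] using h1⟩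
  · rintro g ⟨q, rfl⟩
    have hint (ρ : Measure K) [IsFiniteMeasure ρ] (g : K →ᵇ ℝ) : Integrable g ρ :=
      g.integrable ρ
    induction q using MvPolynomial.induction_on' with
    | monomial u a =>
      have key : ∀ x : K, (MvPolynomial.aeval f (MvPolynomial.monomial u a)) x =
          a * ((x : ℝ × ℝ).1 ^ u 0 * (x : ℝ × ℝ).2 ^ u 1) := by
        intro x
        rw [MvPolynomial.aeval_monomial, Finsupp.prod_fintype _ _ (by simp)]
        simp [Fin.prod_univ_two, f, BoundedContinuousFunction.algebraMap_apply]
      change ∫ x, MvPolynomial.aeval f (MvPolynomial.monomial u a) x ∂_ =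
        ∫ x, MvPolynomial.aeval f (MvPolynomial.monomial u a) x ∂_
      simp only [key]
      rw [integral_const_mul, integral_const_mul]
      congr 1
      rw [integral_subtype_comap hKm (fun x : ℝ × ℝ => x.1 ^ u 0 * x.2 ^ u 1),
        integral_subtype_comap hKm (fun x : ℝ × ℝ => x.1 ^ u 0 * x.2 ^ u 1), hμr, hνr, h]
    | add p q hp hq =>
      have hadd : MvPolynomial.aeval f (p + q) = MvPolynomial.aeval f p + MvPolynomial.aeval f q :=
        map_add _ _ _
      change ∫ x, MvPolynomial.aeval f (p + q) x ∂_ = ∫ x, MvPolynomial.aeval f (p + q) x ∂_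
      simp only [hadd, BoundedContinuousFunction.coe_add, Pi.add_apply]
      rw [integral_add (hint _ _) (hint _ _), integral_add (hint _ _) (hint _ _)]
      exact congrArg₂ _ hp hq

/-- If an integrable function is orthogonal to all monomials in two statistics with values in the
unit interval, its conditional expectation given these statistics vanishes. -/
theorem condExp_eq_zero_of_moments {Ω : Type*} [mΩ : MeasurableSpace Ω] {μ : Measure Ω}
    [IsFiniteMeasure μ] {f : Ω → ℝ} (hf : Integrable f μ) {p : Ω → ℝ × ℝ} (hp : Measurable p)
    (hpm : ∀ᵐ ω ∂μ, p ω ∈ Set.Icc (0 : ℝ × ℝ) 1)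
    (h : ∀ j k : ℕ, ∫ ω, f ω * ((p ω).1 ^ j * (p ω).2 ^ k) ∂μ = 0) :
    μ[f | MeasurableSpace.comap p inferInstance] =ᵐ[μ] 0 := by
  -- The positive and negative parts of `f` become finite measures. Their images under `p` have
  -- equal moments, hence agree, so `f` integrates to zero over every event generated by `p`.
  set P := μ.withDensity fun ω => ENNReal.ofReal (f ω) with hP
  set Q := μ.withDensity fun ω => ENNReal.ofReal (-f ω) with hQ
  have : IsFiniteMeasure P := isFiniteMeasure_withDensity_ofReal hf.2
  have : IsFiniteMeasure Q := isFiniteMeasure_withDensity_ofReal hf.neg.2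
  have hPac : P ≪ μ := withDensity_absolutelyContinuous _ _
  have hQac : Q ≪ μ := withDensity_absolutelyContinuous _ _
  have hmP : AEMeasurable (fun ω => ENNReal.ofReal (f ω)) μ := hf.1.aemeasurable.ennreal_ofReal
  have hmQ : AEMeasurable (fun ω => ENNReal.ofReal (-f ω)) μ :=
    hf.neg.1.aemeasurable.ennreal_ofReal
  have hI (q : Ω → ℝ) (hq : Integrable q μ) (j k : ℕ) :
      Integrable (fun ω => (ENNReal.ofReal (q ω)).toReal • ((p ω).1 ^ j * (p ω).2 ^ k)) μ := by
    have hmeas : Measurable fun x : ℝ × ℝ => x.1 ^ j * x.2 ^ k := by fun_prop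
    refine Integrable.mul_bdd (c := 1) hq.pos_part (hmeas.comp hp).aestronglyMeasurable ?_
    filter_upwards [hpm] with ω hω
    obtain ⟨⟨h1, h2⟩, h3, h4⟩ := hω
    rw [Real.norm_eq_abs,
      abs_of_nonneg (mul_nonneg (pow_nonneg h1 _) (pow_nonneg h2 _))]
    exact mul_le_one₀ (pow_le_one₀ h1 h3) (pow_nonneg h2 _) (pow_le_one₀ h2 h4)
  have hmap : P.map p = Q.map p := by
    refine ext_of_moments ?_ ?_ ?_
    · exact (ae_map_iff hp.aemeasurable measurableSet_Icc).2 (hPac.ae_le hpm)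
    · exact (ae_map_iff hp.aemeasurable measurableSet_Icc).2 (hQac.ae_le hpm)
    · intro j k
      have hmeas : Measurable fun x : ℝ × ℝ => x.1 ^ j * x.2 ^ k := by fun_prop
      rw [integral_map hp.aemeasurable hmeas.aestronglyMeasurable,
        integral_map hp.aemeasurable hmeas.aestronglyMeasurable,
        integral_withDensity_eq_integral_toReal_smul₀ hmP (by simp),
        integral_withDensity_eq_integral_toReal_smul₀ hmQ (by simp), ← sub_eq_zero,
        ← integral_sub, ← h j k]
      · refine integral_congr_ae (Filter.Eventually.of_forall fun ω => ?_)
        simp only [smul_eq_mul, ← sub_mul]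
        congr 1
        rcases le_total 0 (f ω) with h0 | h0
        · rw [ENNReal.toReal_ofReal h0, ENNReal.ofReal_of_nonpos (by linarith)]; simp
        · rw [ENNReal.toReal_ofReal (by linarith : 0 ≤ -f ω), ENNReal.ofReal_of_nonpos h0]; simp
      · exact hI f hf j k
      · exact hI _ hf.neg j k
  symm
  refine ae_eq_condExp_of_forall_setIntegral_eq hp.comap_le hf
    (fun _ _ _ => integrableOn_zero) ?_
    (aestronglyMeasurable_const)
  rintro _ ⟨B, hB, rfl⟩ -
  simp only [Pi.zero_apply, integral_zero]
  have hB' : MeasurableSet (p ⁻¹' B) := hp hB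
  have e : P (p ⁻¹' B) = Q (p ⁻¹' B) := by
    rw [← Measure.map_apply hp hB, hmap, Measure.map_apply hp hB]
  rw [hP, hQ, withDensity_apply _ hB', withDensity_apply _ hB'] at e
  rw [integral_eq_lintegral_pos_part_sub_lintegral_neg_part hf.integrableOn, e, sub_self]

/-! ### Tilting of Gamma laws -/

/-- On a box, the indicator times the product density is a product of functions of single
coordinates, so its integral factors by independence. -/
theorem pi_withDensity {ι : Type*} [Fintype ι] {E : ι → Type*} [∀ i, MeasurableSpace (E i)]
    (μ : ∀ i, Measure (E i)) [∀ i, IsProbabilityMeasure (μ i)] {f : ∀ i, E i → ENNReal}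
    (hf : ∀ i, Measurable (f i)) [∀ i, SigmaFinite ((μ i).withDensity (f i))] :
    Measure.pi (fun i => (μ i).withDensity (f i)) =
      (Measure.pi μ).withDensity fun x => ∏ i, f i (x i) := by
  refine Measure.pi_eq fun s hs => ?_
  rw [withDensity_apply _ (MeasurableSet.univ_pi hs),
    ← lintegral_indicator (MeasurableSet.univ_pi hs)]
  have e : (Set.univ.pi s).indicator (fun x : ∀ i, E i => ∏ i, f i (x i)) =
      fun x => ∏ i, (s i).indicator (f i) (x i) := by
    ext x
    by_cases hx : x ∈ Set.univ.pi s
    · rw [Set.indicator_of_mem hx]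
      exact Finset.prod_congr rfl fun i _ => (Set.indicator_of_mem (hx i trivial) _).symm
    · rw [Set.indicator_of_notMem hx]
      simp only [Set.mem_pi, Set.mem_univ, true_imp_iff, not_forall] at hx
      obtain ⟨i, hi⟩ := hx
      exact (Finset.prod_eq_zero (Finset.mem_univ i) (Set.indicator_of_notMem hi _)).symm
  have hg : ∀ i, Measurable ((s i).indicator (f i)) := fun i => (hf i).indicator (hs i)
  rw [e]
  beta_reduce
  rw [lintegral_prod_eq_prod_lintegral_of_indepFun Finset.univ
    (fun i (x : ∀ i, E i) => (s i).indicator (f i) (x i))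
    (iIndepFun_pi fun i => (hg i).aemeasurable)
    fun i => (hg i).comp (measurable_pi_apply i)]
  refine Finset.prod_congr rfl fun i _ => ?_
  rw [(measurePreserving_eval μ i).lintegral_comp (hg i), lintegral_indicator (hs i),
    withDensity_apply _ (hs i)]

/-- The normalising constant relating the Gamma laws with parameters `(a, r)` and
`(a + k, r + t)`. -/
def tiltConst (a r : ℝ) (k : ℕ) (t : ℝ) : ℝ :=
  (r + t) ^ (a + k) / r ^ a * (Real.Gamma a / Real.Gamma (a + k))

theorem tiltConst_pos {a r t : ℝ} (ha : 0 < a) (hr : 0 < r) (ht : 0 ≤ t) (k : ℕ) :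
    0 < tiltConst a r k t := by
  have h1 := Real.Gamma_pos_of_pos ha
  have h2 : 0 < Real.Gamma (a + k) := Real.Gamma_pos_of_pos (by positivity)
  unfold tiltConst; positivity

theorem ae_gammaMeasure_pos (a r : ℝ) : ∀ᵐ x ∂gammaMeasure a r, 0 < x := by
  have hne : ∀ᵐ x : ℝ, x ≠ 0 := by simp [ae_iff]
  rw [gammaMeasure, ae_withDensity_iff (by unfold gammaPDF; fun_prop)]
  filter_upwards [hne] with x hx0 hx
  rcases lt_or_gt_of_ne hx0 with h | h
  · exact absurd (gammaPDF_of_neg h) hx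
  · exact h

theorem gammaMeasure_tilt {a r t : ℝ} (ha : 0 < a) (hr : 0 < r) (ht : 0 ≤ t) (k : ℕ) :
    gammaMeasure (a + k) (r + t) = (gammaMeasure a r).withDensity fun x =>
      ENNReal.ofReal (tiltConst a r k t * (x ^ k * Real.exp (-(t * x)))) := by
  have hm : Measurable (gammaPDF a r) := by unfold gammaPDF; fun_prop
  rw [gammaMeasure, gammaMeasure, ← withDensity_mul _ hm (by fun_prop)]
  refine withDensity_congr_ae ?_
  have hne : ∀ᵐ x : ℝ, x ≠ 0 := by simp [ae_iff]
  filter_upwards [hne] with x hx0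
  rw [Pi.mul_apply]
  rcases lt_or_gt_of_ne hx0 with h | h
  · rw [gammaPDF_of_neg h, gammaPDF_of_neg h, zero_mul]
  · have h1 := Real.Gamma_pos_of_pos ha
    have h2 : 0 < Real.Gamma (a + k) := Real.Gamma_pos_of_pos (by positivity)
    have h3 : 0 < r ^ a := Real.rpow_pos_of_pos hr a
    rw [gammaPDF_of_nonneg h.le, gammaPDF_of_nonneg h.le, ← ENNReal.ofReal_mul (by positivity)]
    congr 1
    have e1 : x ^ (a + k - 1) = x ^ (a - 1) * x ^ k := by
      rw [← Real.rpow_natCast, ← Real.rpow_add h]; ring_nf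
    have e2 : Real.exp (-((r + t) * x)) = Real.exp (-(r * x)) * Real.exp (-(t * x)) := by
      rw [← Real.exp_add]; ring_nf
    rw [e1, e2, tiltConst]
    field_simp

variable {n : ℕ}

theorem isProbabilityMeasure_law {a r : ℝ} (ha : 0 < a) (hr : 0 < r) :
    IsProbabilityMeasure (law n a r) := by
  have := isProbabilityMeasure_gammaMeasure ha hr
  unfold law; infer_instance

theorem ae_law_pos {a r : ℝ} (ha : 0 < a) (hr : 0 < r) : ∀ᵐ x ∂law n a r, ∀ i, 0 < x i := by
  have := isProbabilityMeasure_gammaMeasure ha hr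
  refine Filter.eventually_all.2 fun i => ?_
  exact (Measure.tendsto_eval_ae_ae (μ := fun _ : Fin n => gammaMeasure a r) (i := i)).eventually
    (ae_gammaMeasure_pos a r)

/-- The exponential family structure. Natural shifts of the shape and nonnegative shifts of the rate
are enough for completeness and for all moments below. -/
theorem law_tilt {a r t : ℝ} (ha : 0 < a) (hr : 0 < r) (ht : 0 ≤ t) (k : ℕ) :
    law n (a + k) (r + t) = (law n a r).withDensity fun x =>
      ENNReal.ofReal (tiltConst a r k t ^ n * ((∏ i, x i) ^ k * Real.exp (-(t * statX x)))) := by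
  have := isProbabilityMeasure_gammaMeasure ha hr
  have hpr : IsProbabilityMeasure (gammaMeasure (a + k) (r + t)) :=
    isProbabilityMeasure_gammaMeasure (by positivity) (by positivity)
  have hsf : SigmaFinite ((gammaMeasure a r).withDensity fun x =>
      ENNReal.ofReal (tiltConst a r k t * (x ^ k * Real.exp (-(t * x))))) := by
    rw [← gammaMeasure_tilt ha hr ht k]; infer_instance
  have hC := tiltConst_pos ha hr ht k
  rw [law, gammaMeasure_tilt ha hr ht k, pi_withDensity _ (fun _ => by fun_prop)]
  refine withDensity_congr_ae ?_
  filter_upwards [ae_law_pos (n := n) ha hr] with x hx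
  rw [← ENNReal.ofReal_prod_of_nonneg fun i _ => by have := hx i; positivity]
  congr 1
  rw [Finset.prod_mul_distrib, Finset.prod_mul_distrib, Finset.prod_const, Finset.card_univ,
    Fintype.card_fin, Finset.prod_pow, ← Real.exp_sum, statX, Finset.mul_sum,
    Finset.sum_neg_distrib]

/-! ### The statistics X and Y -/

@[fun_prop]
theorem measurable_statX : Measurable (statX (n := n)) := by unfold statX; fun_prop

@[fun_prop]
theorem measurable_statY : Measurable (statY (n := n)) := by
  unfold statY geomMean arithMean; fun_prop

theorem statX_pos (hn : 0 < n) {x : Fin n → ℝ} (hx : ∀ i, 0 < x i) : 0 < statX x :=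
  Finset.sum_pos (fun i _ => hx i) ⟨⟨0, hn⟩, Finset.mem_univ _⟩

theorem statY_eq (hn : 0 < n) {x : Fin n → ℝ} (hx : ∀ i, 0 < x i) :
    statY x = n ^ n * (∏ i, x i) / statX x ^ n := by
  have hW : 0 ≤ ∏ i, x i := Finset.prod_nonneg fun i _ => (hx i).le
  rw [statY, geomMean, arithMean, div_pow, div_pow, ← Real.rpow_natCast, ← Real.rpow_mul hW,
    one_div, inv_mul_cancel₀ (by positivity), Real.rpow_one, statX]
  field_simp

theorem statY_mem_Icc (hn : 0 < n) {x : Fin n → ℝ} (hx : ∀ i, 0 < x i) :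
    statY x ∈ Set.Icc (0 : ℝ) 1 := by
  have hW : 0 ≤ ∏ i, x i := Finset.prod_nonneg fun i _ => (hx i).le
  have hX := statX_pos hn hx
  have hn' : (0 : ℝ) < n := by exact_mod_cast hn
  have hA : 0 < arithMean x := div_pos hX hn'
  have hG : 0 ≤ geomMean x := Real.rpow_nonneg hW _
  refine ⟨pow_nonneg (div_nonneg hG hA.le) _, pow_le_one₀ (div_nonneg hG hA.le) ?_⟩
  rw [div_le_one hA]
  have := Real.geom_mean_le_arith_mean Finset.univ (fun _ => (1 : ℝ)) x (by simp)
    (by simpa using hn) fun i _ => (hx i).le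
  simpa [geomMean, arithMean, one_div] using this

/-! ### Integrals under tilting and the law of X -/

theorem tiltConst_rate_zero {a r : ℝ} (hr : 0 < r) (k : ℕ) :
    tiltConst a r k 0 = r ^ k * (Real.Gamma a / Real.Gamma (a + k)) := by
  have h : r ^ a ≠ 0 := (Real.rpow_pos_of_pos hr a).ne'
  rw [tiltConst, add_zero, Real.rpow_add hr, Real.rpow_natCast]
  field_simp

theorem tiltConst_shape_zero {a r t : ℝ} (ha : 0 < a) (hr : 0 < r) (ht : 0 ≤ t) :
    tiltConst a r 0 t = ((r + t) / r) ^ a := by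
  have h := (Real.Gamma_pos_of_pos ha).ne'
  rw [tiltConst, Real.div_rpow (by positivity) hr.le]
  simp [div_self h]

/-- Integration against a measure with real nonnegative density. -/
theorem integral_withDensity_ofReal {Ω : Type*} [MeasurableSpace Ω] {μ : Measure Ω} {h : Ω → ℝ}
    (hm : Measurable h) (h0 : ∀ᵐ x ∂μ, 0 ≤ h x) (f : Ω → ℝ) :
    ∫ x, f x ∂(μ.withDensity fun x => ENNReal.ofReal (h x)) = ∫ x, h x * f x ∂μ := by
  rw [integral_withDensity_eq_integral_toReal_smul hm.ennreal_ofReal (by simp)]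
  refine integral_congr_ae ?_
  filter_upwards [h0] with x hx
  rw [ENNReal.toReal_ofReal hx, smul_eq_mul]

theorem measurable_lawDensity (C t : ℝ) (k : ℕ) : Measurable fun x : Fin n → ℝ =>
    C * ((∏ i, x i) ^ k * Real.exp (-(t * statX x))) := by fun_prop

theorem integral_law_tilt {a r t : ℝ} (ha : 0 < a) (hr : 0 < r) (ht : 0 ≤ t) (k : ℕ)
    (f : (Fin n → ℝ) → ℝ) :
    ∫ x, f x ∂law n (a + k) (r + t) = tiltConst a r k t ^ n *
      ∫ x, ((∏ i, x i) ^ k * Real.exp (-(t * statX x))) * f x ∂law n a r := by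
  have hC := tiltConst_pos ha hr ht k
  rw [law_tilt ha hr ht k, integral_withDensity_ofReal (measurable_lawDensity _ _ _),
    ← integral_const_mul]
  · simp_rw [mul_assoc]
  · filter_upwards [ae_law_pos ha hr] with x hx
    have : 0 ≤ ∏ i, x i := Finset.prod_nonneg fun i _ => (hx i).le
    positivity

theorem integral_gammaMeasure_tilt {a r t : ℝ} (ha : 0 < a) (hr : 0 < r) (ht : 0 ≤ t) (k : ℕ)
    (f : ℝ → ℝ) :
    ∫ x, f x ∂gammaMeasure (a + k) (r + t) = tiltConst a r k t *
      ∫ x, (x ^ k * Real.exp (-(t * x))) * f x ∂gammaMeasure a r := by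
  have hC := tiltConst_pos ha hr ht k
  rw [gammaMeasure_tilt ha hr ht k, integral_withDensity_ofReal (by fun_prop),
    ← integral_const_mul]
  · simp_rw [mul_assoc]
  · filter_upwards [ae_gammaMeasure_pos a r] with x hx
    positivity

theorem integral_exp_gammaMeasure {a r t : ℝ} (ha : 0 < a) (hr : 0 < r) (ht : 0 ≤ t) :
    ∫ x, Real.exp (-(t * x)) ∂gammaMeasure a r = (((r + t) / r) ^ a)⁻¹ := by
  have h := integral_gammaMeasure_tilt ha hr ht 0 fun _ => 1
  have := isProbabilityMeasure_gammaMeasure (a := a + (0 : ℕ)) (r := r + t) (by simpa)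
    (by positivity)
  rw [tiltConst_shape_zero ha hr ht] at h
  simp only [integral_const, probReal_univ, smul_eq_mul, mul_one, pow_zero, one_mul] at h
  exact eq_inv_of_mul_eq_one_right h.symm

theorem integral_exp_law {a r t : ℝ} (ha : 0 < a) (hr : 0 < r) (ht : 0 ≤ t) :
    ∫ x, Real.exp (-(t * statX x)) ∂law n a r = (((r + t) / r) ^ (n * a))⁻¹ := by
  have h := integral_law_tilt (n := n) ha hr ht 0 fun _ => 1
  have := isProbabilityMeasure_law (n := n) (a := a + (0 : ℕ)) (r := r + t) (by simpa)
    (by positivity)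
  rw [tiltConst_shape_zero ha hr ht, ← Real.rpow_natCast, ← Real.rpow_mul (by positivity),
    mul_comm a] at h
  simp only [integral_const, probReal_univ, smul_eq_mul, mul_one, pow_zero, one_mul] at h
  exact eq_inv_of_mul_eq_one_right h.symm

/-- The sum of the sample is Gamma distributed. -/
theorem law_map_statX (hn : 0 < n) {a r : ℝ} (ha : 0 < a) (hr : 0 < r) :
    (law n a r).map statX = gammaMeasure (n * a) r := by
  have hna : 0 < n * a := by positivity
  have := isProbabilityMeasure_law (n := n) ha hr
  have := isProbabilityMeasure_gammaMeasure hna hr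
  have hpr : IsProbabilityMeasure ((law n a r).map statX) :=
    Measure.isProbabilityMeasure_map measurable_statX.aemeasurable
  -- The diagonal embedding brings the one-dimensional problem under the two-dimensional moment
  -- lemma: the moments of `p` are Laplace transforms at natural numbers.
  set p : ℝ → ℝ × ℝ := fun x => (Real.exp (-x), Real.exp (-x)) with hp
  have hpm : Measurable p := by fun_prop
  have hmem : ∀ x : ℝ, 0 < x → p x ∈ Set.Icc (0 : ℝ × ℝ) 1 := fun x hx =>
    ⟨⟨(Real.exp_pos _).le, (Real.exp_pos _).le⟩, by
      constructor <;> simpa [hp] using hx.le⟩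
  have key : ((law n a r).map statX).map p = (gammaMeasure (n * a) r).map p := by
    refine ext_of_moments ?_ ?_ fun j k => ?_
    · refine (ae_map_iff hpm.aemeasurable measurableSet_Icc).2 ?_
      refine (ae_map_iff measurable_statX.aemeasurable (hpm measurableSet_Icc)).2 ?_
      filter_upwards [ae_law_pos ha hr] with x hx using hmem _ (statX_pos hn hx)
    · refine (ae_map_iff hpm.aemeasurable measurableSet_Icc).2 ?_
      filter_upwards [ae_gammaMeasure_pos (n * a) r] with x hx using hmem _ hx
    · have hmeas : Measurable fun x : ℝ × ℝ => x.1 ^ j * x.2 ^ k := by fun_prop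
      have e : ∀ x : ℝ, (p x).1 ^ j * (p x).2 ^ k = Real.exp (-(((j + k : ℕ) : ℝ) * x)) := by
        intro x
        simp only [hp]
        rw [← pow_add, ← Real.exp_nat_mul]; ring_nf
      rw [integral_map hpm.aemeasurable hmeas.aestronglyMeasurable,
        integral_map hpm.aemeasurable hmeas.aestronglyMeasurable]
      simp_rw [e]
      rw [integral_map measurable_statX.aemeasurable (by fun_prop),
        integral_exp_law ha hr (by positivity), integral_exp_gammaMeasure hna hr (by positivity)]
  have hinv : (fun q : ℝ × ℝ => -Real.log q.1) ∘ p = id := by ext x; simp [hp]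
  have hlm : Measurable fun q : ℝ × ℝ => -Real.log q.1 := by fun_prop
  have := congrArg (Measure.map fun q : ℝ × ℝ => -Real.log q.1) key
  rwa [Measure.map_map hlm hpm, Measure.map_map hlm hpm, hinv, Measure.map_id, Measure.map_id]
    at this

theorem integral_inv_pow_gammaMeasure {a r : ℝ} (ha : 0 < a) (hr : 0 < r) (N : ℕ) :
    ∫ x, (x ^ N)⁻¹ ∂gammaMeasure (a + N) r = tiltConst a r N 0 := by
  have h := integral_gammaMeasure_tilt ha hr le_rfl N fun x => (x ^ N)⁻¹
  have := isProbabilityMeasure_gammaMeasure ha hr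
  rw [add_zero] at h
  rw [h, integral_congr_ae (g := fun _ => (1 : ℝ))]
  · simp
  · filter_upwards [ae_gammaMeasure_pos a r] with x hx
    have : x ≠ 0 := hx.ne'
    simp [this]

/-! ### Moments of Y -/

/-- The `k`-th moment of `Y`. -/
def momentY (n : ℕ) (a : ℝ) (k : ℕ) : ℝ :=
  n ^ (n * k) * (Real.Gamma (n * a) / Real.Gamma (n * a + (n * k : ℕ))) *
    (Real.Gamma (a + k) / Real.Gamma a) ^ n

theorem integral_statY_pow (hn : 0 < n) {a r : ℝ} (ha : 0 < a) (hr : 0 < r) (k : ℕ) :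
    ∫ x, statY x ^ k ∂law n a r = momentY n a k := by
  have hna : 0 < n * a := by positivity
  have hC := tiltConst_pos ha hr le_rfl k
  -- The mean of X^{-nk} at shape a + k is known from the law of X. Tilted back to shape a, it is
  -- the mean of (∏ xᵢ)^k X^{-nk} = n^{-nk} Y^k up to the tilting constant.
  have h := integral_law_tilt (n := n) ha hr le_rfl k fun x => (statX x ^ (n * k))⁻¹
  have h1 : ∫ x, (statX x ^ (n * k))⁻¹ ∂law n (a + k) r = tiltConst (n * a) r (n * k) 0 := by
    rw [← integral_inv_pow_gammaMeasure hna hr,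
      ← integral_map (f := fun x : ℝ => (x ^ (n * k))⁻¹) measurable_statX.aemeasurable
        (by fun_prop), law_map_statX hn (by positivity) hr]
    congr 2; push_cast; ring
  rw [add_zero, h1] at h
  have h2 : ∫ x, statY x ^ k ∂law n a r = n ^ (n * k) *
      ∫ x, ((∏ i, x i) ^ k * Real.exp (-(0 * statX x))) * (statX x ^ (n * k))⁻¹ ∂law n a r := by
    rw [← integral_const_mul]
    refine integral_congr_ae ?_
    filter_upwards [ae_law_pos ha hr] with x hx
    have := statX_pos hn hx
    rw [statY_eq hn hx, div_pow, mul_pow, ← pow_mul, ← pow_mul]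
    simp; ring
  have h3 : 0 < tiltConst a r k 0 ^ n := by positivity
  have g1 := (Real.Gamma_pos_of_pos ha).ne'
  have g2 : Real.Gamma (a + k) ≠ 0 := (Real.Gamma_pos_of_pos (by positivity)).ne'
  rw [h2, ← (div_eq_iff h3.ne').2 (h.trans (mul_comm _ _)), tiltConst_rate_zero hr,
    tiltConst_rate_zero hr, momentY, mul_pow, div_pow, div_pow]
  field_simp
  ring

theorem Gamma_add_nat_eq_prod {x : ℝ} (hx : 0 < x) (N : ℕ) :
    Real.Gamma (x + N) = (∏ j ∈ Finset.range N, (x + j)) * Real.Gamma x := by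
  induction N with
  | zero => simp
  | succ N ih =>
    rw [Finset.prod_range_succ, Nat.cast_succ, ← add_assoc, Real.Gamma_add_one (by positivity), ih]
    ring

theorem momentY_zero (n : ℕ) {a : ℝ} (hn : 0 < n) (ha : 0 < a) : momentY n a 0 = 1 := by
  have hna : 0 < n * a := by positivity
  simp [momentY, (Real.Gamma_pos_of_pos ha).ne', (Real.Gamma_pos_of_pos hna).ne']

theorem momentY_succ (hn : 0 < n) {a : ℝ} (ha : 0 < a) (k : ℕ) :
    momentY n a (k + 1) =
      momentY n a k * ∏ j ∈ Finset.range n, (a + k) / (a + k + j / n) := by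
  have hna : 0 < n * a := by positivity
  have hn' : (n : ℝ) ≠ 0 := by positivity
  have g1 := (Real.Gamma_pos_of_pos ha).ne'
  have g2 : Real.Gamma (a + k) ≠ 0 := (Real.Gamma_pos_of_pos (by positivity)).ne'
  have g3 : Real.Gamma (n * a + (n * k : ℕ)) ≠ 0 := (Real.Gamma_pos_of_pos (by positivity)).ne'
  have e1 : Real.Gamma (n * a + (n * (k + 1) : ℕ)) =
      (n ^ n * ∏ j ∈ Finset.range n, (a + k + j / n)) * Real.Gamma (n * a + (n * k : ℕ)) := by
    have : n * a + ((n * (k + 1) : ℕ) : ℝ) = (n * a + (n * k : ℕ)) + n := by push_cast; ring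
    rw [this, Gamma_add_nat_eq_prod (by positivity)]
    congr 1
    conv_rhs => rw [← Finset.card_range n, ← Finset.prod_const, Finset.card_range,
      ← Finset.prod_mul_distrib]
    refine Finset.prod_congr rfl fun j _ => ?_
    push_cast; field_simp
  have e2 : Real.Gamma (a + (k + 1 : ℕ)) = (a + k) * Real.Gamma (a + k) := by
    rw [Nat.cast_succ, ← add_assoc, Real.Gamma_add_one (by positivity)]
  have hprod : ∏ j ∈ Finset.range n, (a + k + j / n) ≠ 0 :=
    Finset.prod_ne_zero_iff.2 fun j _ => by positivity
  rw [momentY, momentY, e1, e2, Finset.prod_div_distrib, Finset.prod_const, Finset.card_range,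
    mul_add, pow_add, mul_one, mul_div_assoc, mul_pow, div_pow]
  field_simp

/-! ### Beta integrals and the expansion with coefficients γ -/

theorem lintegral_rpow_mul_one_sub_rpow {a b : ℝ} (ha : 0 < a) (hb : 0 < b) :
    ∫⁻ y in Set.Ioo (0 : ℝ) 1, ENNReal.ofReal (y ^ (a - 1) * (1 - y) ^ (b - 1)) =
      ENNReal.ofReal (beta a b) := by
  have hB := beta_pos ha hb
  have h := lintegral_betaPDF_eq_one ha hb
  rw [lintegral_betaPDF] at h
  have e : ∀ y : ℝ, ENNReal.ofReal (1 / beta a b * y ^ (a - 1) * (1 - y) ^ (b - 1)) =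
      ENNReal.ofReal (1 / beta a b) * ENNReal.ofReal (y ^ (a - 1) * (1 - y) ^ (b - 1)) := by
    intro y
    rw [← ENNReal.ofReal_mul (by positivity), mul_assoc]
  simp_rw [e] at h
  rw [lintegral_const_mul _ (by fun_prop)] at h
  calc _ = ENNReal.ofReal (beta a b) * (ENNReal.ofReal (1 / beta a b) *
        ∫⁻ y in Set.Ioo (0 : ℝ) 1, ENNReal.ofReal (y ^ (a - 1) * (1 - y) ^ (b - 1))) := by
        rw [← mul_assoc, ← ENNReal.ofReal_mul hB.le, mul_one_div_cancel hB.ne']; simp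
    _ = _ := by rw [h, mul_one]

theorem choose_eq_Gamma {b : ℝ} (hb : 0 < b) (l : ℕ) :
    Ring.choose (b + l - 1) l = Real.Gamma (l + b) / l.factorial / Real.Gamma b := by
  have hG := (Real.Gamma_pos_of_pos hb).ne'
  have h1 : ∀ l : ℕ, (ascPochhammer ℝ l).eval b * Real.Gamma b = Real.Gamma (l + b) := by
    intro l
    induction l with
    | zero => simp
    | succ l ih =>
      rw [ascPochhammer_succ_eval, mul_right_comm, ih, Nat.cast_succ,
        show (l : ℝ) + 1 + b = (l + b) + 1 by ring, Real.Gamma_add_one (by positivity)]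
      ring
  have h2 := Ring.factorial_nsmul_multichoose_eq_ascPochhammer b l
  rw [Polynomial.ascPochhammer_smeval_eq_eval, nsmul_eq_mul] at h2
  have h3 : Ring.choose (b + l - 1) l = Ring.multichoose b l := by
    rw [Ring.choose]; congr 1; ring
  have hl : (l.factorial : ℝ) ≠ 0 := by positivity
  rw [h3, ← h1, ← h2]
  field_simp

theorem hasSum_Gamma_div_factorial_mul_pow {b t : ℝ} (hb : 0 < b) (ht : t ∈ Set.Ioo (0 : ℝ) 1) :
    HasSum (fun l : ℕ => Real.Gamma (l + b) / l.factorial * t ^ l)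
      (Real.Gamma b * (1 - t) ^ (-b)) := by
  have hG := (Real.Gamma_pos_of_pos hb).ne'
  have h := (Real.one_div_one_sub_rpow_hasFPowerSeriesOnBall_zero b).hasSum (y := t) (by
    simp only [Metric.mem_eball, edist_zero_right]
    rw [← ofReal_norm, Real.norm_eq_abs, abs_of_pos ht.1]
    simpa using ht.2)
  have h' := h.mul_left (Real.Gamma b)
  rw [zero_add, one_div, ← Real.rpow_neg (by linarith [ht.2])] at h'
  refine h'.congr_fun ?_
  intro l
  simp [choose_eq_Gamma hb]
  field_simp

/-- Under the beta integral, the binomial series ∑ Γ(l+b)/l! t^l = Γ(b)(1-t)^{-b} lowers the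
exponent of 1 - t from s + b - 1 to s - 1. Working in `ENNReal` makes the exchange of sum and
integral free. -/
theorem tsum_Gamma_mul_beta {b c s : ℝ} (hb : 0 < b) (hc : 0 < c) (hs : 0 < s) :
    ∑' l : ℕ, ENNReal.ofReal (Real.Gamma (l + b) / l.factorial * beta (s + b) (l + c)) =
      ENNReal.ofReal (Real.Gamma b * beta s c) := by
  have hG : ∀ l : ℕ, 0 ≤ Real.Gamma (l + b) / l.factorial := fun l =>
    div_nonneg (Real.Gamma_pos_of_pos (by positivity)).le (by positivity)
  have hGb := Real.Gamma_pos_of_pos hb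
  have e : ∀ l : ℕ, ENNReal.ofReal (Real.Gamma (l + b) / l.factorial * beta (s + b) (l + c)) =
      ∫⁻ t in Set.Ioo (0 : ℝ) 1, ENNReal.ofReal (Real.Gamma (l + b) / l.factorial) *
        ENNReal.ofReal ((1 - t) ^ (s + b - 1) * t ^ (l + c - 1)) := by
    intro l
    have : beta (s + b) (l + c) = beta (l + c) (s + b) := by
      rw [beta, beta, add_comm (s + b), mul_comm (Real.Gamma (s + b))]
    rw [lintegral_const_mul _ (by fun_prop), ENNReal.ofReal_mul (hG l), this,
      ← lintegral_rpow_mul_one_sub_rpow (by positivity) (by positivity)]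
    simp_rw [mul_comm]
  have hsymm : beta s c = beta c s := by
    rw [beta, beta, add_comm s, mul_comm (Real.Gamma s)]
  simp_rw [e]
  rw [← lintegral_tsum (fun l => by fun_prop), ENNReal.ofReal_mul hGb.le, hsymm,
    ← lintegral_rpow_mul_one_sub_rpow hc hs, ← lintegral_const_mul _ (by fun_prop)]
  refine setLIntegral_congr_fun measurableSet_Ioo fun t ht => ?_
  have h1t : 0 < 1 - t := by linarith [ht.2]
  have h0t : 0 < t := ht.1
  have hsum := hasSum_Gamma_div_factorial_mul_pow hb ht
  have e2 : ∀ l : ℕ, ENNReal.ofReal (Real.Gamma (l + b) / l.factorial) *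
        ENNReal.ofReal ((1 - t) ^ (s + b - 1) * t ^ (l + c - 1)) =
      ENNReal.ofReal (Real.Gamma (l + b) / l.factorial * t ^ l) *
        ENNReal.ofReal ((1 - t) ^ (s + b - 1) * t ^ (c - 1)) := by
    intro l
    rw [← ENNReal.ofReal_mul (hG l),
      ← ENNReal.ofReal_mul (mul_nonneg (hG l) (by positivity)),
      show (l : ℝ) + c - 1 = l + (c - 1) by ring, Real.rpow_add h0t, Real.rpow_natCast]
    ring_nf
  simp_rw [e2]
  rw [ENNReal.tsum_mul_right, ← ENNReal.ofReal_tsum_of_nonneg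
    (fun l => mul_nonneg (hG l) (by positivity)) hsum.summable, hsum.tsum_eq,
    ← ENNReal.ofReal_mul (by positivity), ← ENNReal.ofReal_mul hGb.le]
  congr 1
  rw [show s + b - 1 = (s - 1) + b by ring, Real.rpow_add h1t, Real.rpow_neg h1t.le]
  have := (Real.rpow_pos_of_pos h1t b).ne'
  field_simp

theorem tsum_sum_range_sub (f : ℕ → ℕ → ENNReal) :
    ∑' m, ∑ k ∈ Finset.range (m + 1), f k (m - k) = ∑' k, ∑' l, f k l := by
  have h : ∑' p : ℕ × ℕ, f p.1 p.2 = ∑' k, ∑' l, f k l := ENNReal.tsum_prod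
  rw [← h, ← (Finset.HasAntidiagonal.sigmaAntidiagonalEquivProd (A := ℕ)).tsum_eq,
    ENNReal.tsum_sigma']
  refine tsum_congr fun m => ?_
  rw [← Finset.Nat.sum_antidiagonal_eq_sum_range_succ f, tsum_fintype,
    ← Finset.sum_coe_sort]
  rfl

theorem gammaCoeff_nonneg {n : ℕ} (hn : 0 < n) (i m : ℕ) : 0 ≤ gammaCoeff n i m := by
  induction i using Nat.strong_induction_on generalizing m with
  | _ i ih =>
    match i, ih with
    | 0, _ => simp [gammaCoeff]
    | 1, _ => rw [gammaCoeff]; split_ifs <;> simp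
    | i + 2, ih =>
      rw [gammaCoeff]
      refine mul_nonneg (div_nonneg (Real.Gamma_nonneg_of_nonneg (by positivity))
        (Real.Gamma_nonneg_of_nonneg (by positivity))) (Finset.sum_nonneg fun k _ => ?_)
      exact mul_nonneg (div_nonneg (Real.Gamma_nonneg_of_nonneg (by positivity)) (by positivity))
        (ih _ (by lia) k)

theorem gammaCoeff_zero_pos {n : ℕ} (hn : 0 < n) (i : ℕ) : 0 < gammaCoeff n (i + 1) 0 := by
  induction i with
  | zero => simp [gammaCoeff]
  | succ i ih =>
    rw [gammaCoeff]
    have h1 : 0 < Real.Gamma ((0 : ℕ) + ((i : ℝ) + 1) * (i + 2) / (2 * n)) :=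
      Real.Gamma_pos_of_pos (by positivity)
    have h2 : 0 < Real.Gamma ((0 : ℕ) + ((i : ℝ) + 2) * (i + 3) / (2 * n)) :=
      Real.Gamma_pos_of_pos (by positivity)
    have h3 : 0 < Real.Gamma (((0 - 0 : ℕ) : ℝ) + ((i : ℝ) + 2) / n) :=
      Real.Gamma_pos_of_pos (by positivity)
    rw [zero_add, Finset.sum_range_one]
    positivity

/-- The identity for which the recursion is made: each step absorbs one more factor B(s, (i+2)/n)
into the series, and the second beta parameter grows by (i+2)/n. The resulting double series is a
Cauchy product, rearranged freely since its terms are nonnegative. -/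
theorem tsum_gammaCoeff_mul_beta {n : ℕ} (hn : 0 < n) {s : ℝ} (hs : 0 < s) (i : ℕ) :
    ∑' m : ℕ, ENNReal.ofReal
        (gammaCoeff n (i + 1) m * beta s (m + ((i : ℝ) + 1) * (i + 2) / (2 * n))) =
      ENNReal.ofReal (∏ j ∈ Finset.range (i + 1), beta s (((j : ℝ) + 1) / n)) := by
  have hn' : (0 : ℝ) < n := by positivity
  induction i with
  | zero =>
    rw [tsum_eq_single 0 (by intro m hm; simp [gammaCoeff, hm])]
    simp only [gammaCoeff]
    congr 1
    norm_num
    congr 1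
    field_simp
  | succ i ih =>
    set a : ℝ := ((i : ℝ) + 1) * (i + 2) / (2 * n) with ha_def
    set b : ℝ := ((i : ℝ) + 2) / n with hb_def
    have ha : 0 < a := by positivity
    have hb : 0 < b := by positivity
    have hab : ((i : ℝ) + 2) * (i + 3) / (2 * n) = a + b := by
      rw [ha_def, hb_def]; field_simp; ring
    have hsb := Real.Gamma_pos_of_pos (add_pos hs hb)
    have hsG := Real.Gamma_pos_of_pos hs
    -- The Gamma quotient in the recursion turns B(s, m+a+b) into B(s+b, m+a) up to the factor
    -- Γ(s)/Γ(s+b), because s + (m+a+b) = (s+b) + (m+a).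
    have hcoef : ∀ m : ℕ, ENNReal.ofReal (gammaCoeff n (i + 1 + 1) m *
        beta s (m + (((i + 1 : ℕ) : ℝ) + 1) * ((i + 1 : ℕ) + 2) / (2 * n))) =
        ENNReal.ofReal (Real.Gamma s / Real.Gamma (s + b)) *
          ∑ k ∈ Finset.range (m + 1), ENNReal.ofReal (gammaCoeff n (i + 1) k) *
            ENNReal.ofReal (Real.Gamma ((m - k : ℕ) + b) / (m - k).factorial *
              beta (s + b) ((m - k : ℕ) + (k + a))) := by
      intro m
      have hma := (Real.Gamma_pos_of_pos (show 0 < m + (a + b) by positivity)).ne'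
      have e1 : ∀ k ∈ Finset.range (m + 1), ENNReal.ofReal (gammaCoeff n (i + 1) k) *
            ENNReal.ofReal (Real.Gamma ((m - k : ℕ) + b) / (m - k).factorial *
              beta (s + b) ((m - k : ℕ) + (k + a))) =
          ENNReal.ofReal (Real.Gamma ((m - k : ℕ) + b) / (m - k).factorial *
            gammaCoeff n (i + 1) k * beta (s + b) (m + a)) := by
        intro k hk
        have hkm : k ≤ m := Nat.lt_succ_iff.1 (Finset.mem_range.1 hk)
        rw [← ENNReal.ofReal_mul (gammaCoeff_nonneg hn _ _), ← add_assoc, Nat.cast_sub hkm,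
          sub_add_cancel]
        ring_nf
      rw [Finset.sum_congr rfl e1, ← ENNReal.ofReal_sum_of_nonneg, ← ENNReal.ofReal_mul
        (by positivity)]
      · congr 1
        rw [gammaCoeff, hab, ← Finset.sum_mul, ← ha_def, ← hb_def]
        have : (((i + 1 : ℕ) : ℝ) + 1) * ((i + 1 : ℕ) + 2) / (2 * n) = a + b := by
          rw [← hab]; push_cast; ring
        rw [this, beta, beta, show s + (m + (a + b)) = s + b + (m + a) by ring]
        generalize Finset.sum (M := ℝ) _ _ = S
        field_simp
      · intro k _
        have := gammaCoeff_nonneg hn (i + 1) k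
        have h2 : 0 ≤ Real.Gamma (((m - k : ℕ) : ℝ) + b) :=
          Real.Gamma_nonneg_of_nonneg (by positivity)
        have h3 := beta_pos (show 0 < s + b by positivity) (show 0 < m + a by positivity)
        positivity
    simp_rw [hcoef]
    rw [ENNReal.tsum_mul_left, tsum_sum_range_sub fun k l =>
      ENNReal.ofReal (gammaCoeff n (i + 1) k) *
            ENNReal.ofReal (Real.Gamma (l + b) / l.factorial * beta (s + b) (l + (k + a)))]
    simp_rw [ENNReal.tsum_mul_left]
    have e3 : ∀ k : ℕ, ∑' l : ℕ, ENNReal.ofReal (Real.Gamma (l + b) / l.factorial *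
        beta (s + b) (l + (k + a))) = ENNReal.ofReal (Real.Gamma b * beta s (k + a)) :=
      fun k => tsum_Gamma_mul_beta hb (by positivity) hs
    have hbG := Real.Gamma_pos_of_pos hb
    simp_rw [e3, ENNReal.ofReal_mul hbG.le, ← mul_assoc, mul_comm _ (ENNReal.ofReal (Real.Gamma b)),
      mul_assoc, ENNReal.tsum_mul_left, ← ENNReal.ofReal_mul (gammaCoeff_nonneg hn _ _), ih]
    have hp : 0 ≤ ∏ j ∈ Finset.range (i + 1), beta s (((j : ℝ) + 1) / n) :=
      Finset.prod_nonneg fun j _ => (beta_pos hs (by positivity)).le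
    rw [Finset.prod_range_succ _ (i + 1), ← mul_assoc, ← ENNReal.ofReal_mul (by positivity),
      ← ENNReal.ofReal_mul (by positivity), mul_comm]
    congr 2
    rw [beta]
    have : (((i + 1 : ℕ) : ℝ) + 1) / n = b := by rw [hb_def]; push_cast; ring
    rw [this]; ring

/-! ### Convergence of G and the law of Y -/

theorem d_nonneg (hn : 2 ≤ n) (m : ℕ) : 0 ≤ d n m := gammaCoeff_nonneg (by lia) _ _

theorem d_zero_pos (hn : 2 ≤ n) : 0 < d n 0 := by
  obtain ⟨i, rfl⟩ := Nat.exists_eq_add_of_le' hn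
  exact gammaCoeff_zero_pos (by lia) i

/-- The Mellin transform of the density of `Y`, up to a normalising constant. -/
def mellinY (n : ℕ) (s : ℝ) : ℝ := ∏ j ∈ Finset.range (n - 1), beta s (((j : ℝ) + 1) / n)

theorem mellinY_pos (hn : 2 ≤ n) {s : ℝ} (hs : 0 < s) : 0 < mellinY n s :=
  Finset.prod_pos fun j _ => beta_pos hs (by positivity)

theorem tsum_d_mul_beta (hn : 2 ≤ n) {s : ℝ} (hs : 0 < s) :
    ∑' m : ℕ, ENNReal.ofReal (d n m * beta s (m + ((n : ℝ) - 1) / 2)) =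
      ENNReal.ofReal (mellinY n s) := by
  obtain ⟨i, rfl⟩ := Nat.exists_eq_add_of_le' hn
  have h := tsum_gammaCoeff_mul_beta (n := i + 2) (by lia) hs i
  have e : ((i : ℝ) + 1) * (i + 2) / (2 * (i + 2 : ℕ)) = (((i + 2 : ℕ) : ℝ) - 1) / 2 := by
    push_cast; field_simp; ring
  rw [e] at h
  exact h

/-- Tonelli needs no prior convergence of the series; the finite value is what yields the
convergence of G. -/
theorem lintegral_rpow_mul_tsum_d (hn : 2 ≤ n) {s : ℝ} (hs : 0 < s) :
    ∫⁻ y in Set.Ioo (0 : ℝ) 1, ∑' m : ℕ, ENNReal.ofReal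
        (d n m * (y ^ (s - 1) * (1 - y) ^ (m + ((n : ℝ) - 1) / 2 - 1))) =
      ENNReal.ofReal (mellinY n s) := by
  have hn' : (2 : ℝ) ≤ n := by exact_mod_cast hn
  rw [lintegral_tsum (fun m => by fun_prop), ← tsum_d_mul_beta hn hs]
  refine tsum_congr fun m => ?_
  rw [ENNReal.ofReal_mul (d_nonneg hn m),
    ← lintegral_rpow_mul_one_sub_rpow hs (by have : (0 : ℝ) ≤ m := m.cast_nonneg; linarith),
    ← lintegral_const_mul _ (by fun_prop)]
  simp_rw [ENNReal.ofReal_mul (d_nonneg hn m)]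

theorem summable_d_mul_pow (hn : 2 ≤ n) {y : ℝ} (hy : y ∈ Set.Ioo (0 : ℝ) 1) :
    Summable fun m : ℕ => d n m * (1 - y) ^ m := by
  have h := lintegral_rpow_mul_tsum_d hn one_pos
  have hfin := ae_lt_top' (μ := volume.restrict (Set.Ioo (0 : ℝ) 1)) (f := fun y =>
    ∑' m : ℕ, ENNReal.ofReal (d n m * (y ^ ((1 : ℝ) - 1) * (1 - y) ^ (m + ((n : ℝ) - 1) / 2 - 1))))
    (by fun_prop) (by rw [h]; exact ENNReal.ofReal_ne_top)
  -- The series is finite almost everywhere, hence at some `y'` below `y`; its terms are nonnegative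
  -- and decrease in y, so it converges at `y` too.
  obtain ⟨y', hy', hlt⟩ : ∃ y' ∈ Set.Ioo (0 : ℝ) y,
      ∑' m : ℕ, ENNReal.ofReal
        (d n m * (y' ^ ((1 : ℝ) - 1) * (1 - y') ^ (m + ((n : ℝ) - 1) / 2 - 1))) < ⊤ := by
    by_contra! hcon
    have hsub : Set.Ioo (0 : ℝ) y ⊆ Set.Ioo 0 1 := Set.Ioo_subset_Ioo_right hy.2.le
    have h2 := ae_restrict_of_ae_restrict_of_subset hsub hfin
    rw [ae_restrict_iff' measurableSet_Ioo] at h2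
    have h3 : volume (Set.Ioo (0 : ℝ) y) = 0 := by
      refine measure_mono_null ?_ (ae_iff.1 h2)
      intro z hz
      simp only [Set.mem_ofPred_eq, not_forall]
      exact ⟨hz, not_lt.2 (hcon z hz)⟩
    simp at h3
    linarith [hy.1]
  have h1y' : 0 < 1 - y' := by linarith [hy'.2, hy.2]
  have hs := ENNReal.summable_toReal hlt.ne
  have hc : (1 - y') ^ (((n : ℝ) - 1) / 2 - 1) ≠ 0 := (Real.rpow_pos_of_pos h1y' _).ne'
  have e : ∀ m : ℕ, (ENNReal.ofReal (d n m * (y' ^ ((1 : ℝ) - 1) *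
      (1 - y') ^ (m + ((n : ℝ) - 1) / 2 - 1)))).toReal =
      d n m * (1 - y') ^ m * (1 - y') ^ (((n : ℝ) - 1) / 2 - 1) := by
    intro m
    have hd := d_nonneg hn m
    rw [sub_self, Real.rpow_zero, one_mul, ENNReal.toReal_ofReal (by positivity), add_sub_assoc,
      Real.rpow_add h1y', Real.rpow_natCast, mul_assoc]
  simp_rw [e] at hs
  rw [summable_mul_right_iff hc] at hs
  refine Summable.of_nonneg_of_le (fun m => mul_nonneg (d_nonneg hn m)
    (pow_nonneg (by linarith [hy.2]) _)) (fun m => ?_) hs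
  exact mul_le_mul_of_nonneg_left (pow_le_pow_left₀ (by linarith [hy.2]) (by linarith [hy'.2]) _)
    (d_nonneg hn m)

theorem d_zero_le_G (hn : 2 ≤ n) {y : ℝ} (hy : y ∈ Set.Ioo (0 : ℝ) 1) : d n 0 ≤ G n y := by
  have h := (summable_d_mul_pow hn hy).le_tsum 0 fun m _ =>
    mul_nonneg (d_nonneg hn m) (pow_nonneg (by linarith [hy.2]) _)
  simpa [G] using h

theorem G_pos (hn : 2 ≤ n) {y : ℝ} (hy : y ∈ Set.Ioo (0 : ℝ) 1) : 0 < G n y :=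
  (d_zero_pos hn).trans_le (d_zero_le_G hn hy)

@[fun_prop]
theorem measurable_G (n : ℕ) : Measurable (G n) := by
  unfold G
  exact Measurable.tsum fun m => by fun_prop

/-- The density of `Y` on `(0, 1)`, up to a normalising constant. -/
def densY (n : ℕ) (a y : ℝ) : ℝ := y ^ (a - 1) * ((1 - y) ^ (((n : ℝ) - 3) / 2) * G n y)

@[fun_prop]
theorem measurable_densY (n : ℕ) (a : ℝ) : Measurable (densY n a) := by
  unfold densY; fun_prop

theorem densY_pos (hn : 2 ≤ n) (a : ℝ) {y : ℝ} (hy : y ∈ Set.Ioo (0 : ℝ) 1) : 0 < densY n a y :=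
  mul_pos (Real.rpow_pos_of_pos hy.1 _)
    (mul_pos (Real.rpow_pos_of_pos (by linarith [hy.2]) _) (G_pos hn hy))

theorem lintegral_densY (hn : 2 ≤ n) {a : ℝ} (ha : 0 < a) :
    ∫⁻ y in Set.Ioo (0 : ℝ) 1, ENNReal.ofReal (densY n a y) = ENNReal.ofReal (mellinY n a) := by
  rw [← lintegral_rpow_mul_tsum_d hn ha]
  refine setLIntegral_congr_fun measurableSet_Ioo fun y hy => ?_
  have hz : 0 < 1 - y := by linarith [hy.2]
  have hy0 := hy.1
  have e : ∀ m : ℕ, d n m * (y ^ (a - 1) * (1 - y) ^ (m + ((n : ℝ) - 1) / 2 - 1)) =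
      (y ^ (a - 1) * (1 - y) ^ (((n : ℝ) - 3) / 2)) * (d n m * (1 - y) ^ m) := by
    intro m
    rw [show (m : ℝ) + ((n : ℝ) - 1) / 2 - 1 = m + ((n : ℝ) - 3) / 2 by ring, Real.rpow_add hz,
      Real.rpow_natCast]
    ring
  have hs := summable_d_mul_pow hn hy
  simp_rw [e]
  rw [← ENNReal.ofReal_tsum_of_nonneg (fun m => by have := d_nonneg hn m; positivity)
    (hs.mul_left _), tsum_mul_left, densY, G, mul_assoc]

theorem beta_add_one {s b : ℝ} (hs : 0 < s) (hb : 0 < b) :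
    beta (s + 1) b = beta s b * (s / (s + b)) := by
  have h := (Real.Gamma_pos_of_pos (add_pos hs hb)).ne'
  have hsb : s + b ≠ 0 := (add_pos hs hb).ne'
  rw [beta, beta, Real.Gamma_add_one hs.ne', show s + 1 + b = s + b + 1 by ring,
    Real.Gamma_add_one hsb]
  field_simp

theorem mellinY_add_nat (hn : 2 ≤ n) {a : ℝ} (ha : 0 < a) (k : ℕ) :
    mellinY n (a + k) = mellinY n a * momentY n a k := by
  induction k with
  | zero => simp [momentY_zero n (by lia) ha]
  | succ k ih =>
    rw [momentY_succ (by lia) ha, ← mul_assoc, ← ih, Nat.cast_succ, ← add_assoc, mellinY, mellinY]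
    obtain ⟨i, rfl⟩ := Nat.exists_eq_add_of_le' hn
    -- The factor j = 0 of the moment ratio equals 1; this leaves n - 1 beta factors.
    rw [show i + 2 - 1 = i + 1 by lia, Finset.prod_range_succ' _ (i + 1),
      Finset.prod_congr rfl fun (j : ℕ) _ => beta_add_one (s := a + k) (by positivity)
        (show 0 < ((j : ℝ) + 1) / (i + 2 : ℕ) by positivity), Finset.prod_mul_distrib]
    have : a + k ≠ 0 := by positivity
    simp [this]

/-- The law of `Y`. -/
theorem law_map_statY (hn : 2 ≤ n) {a r : ℝ} (ha : 0 < a) (hr : 0 < r) :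
    (law n a r).map statY = (volume.restrict (Set.Ioo (0 : ℝ) 1)).withDensity fun y =>
      ENNReal.ofReal (densY n a y / mellinY n a) := by
  have hn0 : 0 < n := by lia
  have hM := mellinY_pos hn ha
  have := isProbabilityMeasure_law (n := n) ha hr
  set Q : Measure ℝ := (volume.restrict (Set.Ioo (0 : ℝ) 1)).withDensity fun y =>
      ENNReal.ofReal (densY n a y / mellinY n a) with hQ
  have hQac : Q ≪ volume.restrict (Set.Ioo (0 : ℝ) 1) := withDensity_absolutelyContinuous _ _
  have hQmem : ∀ᵐ y ∂Q, y ∈ Set.Ioo (0 : ℝ) 1 := hQac.ae_le (ae_restrict_mem measurableSet_Ioo)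
  have hmomE : ∀ k : ℕ, ∫⁻ y, ENNReal.ofReal (y ^ k) ∂Q = ENNReal.ofReal (momentY n a k) := by
    intro k
    have hak : 0 < a + k := by positivity
    rw [hQ, lintegral_withDensity_eq_lintegral_mul _ (by fun_prop) (by fun_prop)]
    have e : ∫⁻ y in Set.Ioo (0 : ℝ) 1, ((fun y => ENNReal.ofReal (densY n a y / mellinY n a)) *
          fun y => ENNReal.ofReal (y ^ k)) y =
        ∫⁻ y in Set.Ioo (0 : ℝ) 1, ENNReal.ofReal (mellinY n a)⁻¹ *
          ENNReal.ofReal (densY n (a + k) y) := by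
      refine setLIntegral_congr_fun measurableSet_Ioo fun y hy => ?_
      have h1 := densY_pos hn a hy
      rw [Pi.mul_apply, ← ENNReal.ofReal_mul (by positivity), ← ENNReal.ofReal_mul (by positivity),
        densY, densY, show a + k - 1 = (a - 1) + k by ring, Real.rpow_add hy.1, Real.rpow_natCast]
      ring_nf
    rw [e, lintegral_const_mul _ (by fun_prop), lintegral_densY hn hak,
      ← ENNReal.ofReal_mul (by positivity), mellinY_add_nat hn ha, inv_mul_cancel_left₀ hM.ne']
  have hQp : IsProbabilityMeasure Q := ⟨by simpa [momentY_zero n hn0 ha] using hmomE 0⟩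
  have hPp : IsProbabilityMeasure ((law n a r).map statY) :=
    Measure.isProbabilityMeasure_map measurable_statY.aemeasurable
  have hmom : ∀ k : ℕ, ∫ y, y ^ k ∂Q = momentY n a k := by
    intro k
    have h0 : 0 ≤ momentY n a k := by
      have h1 := mellinY_pos hn (show 0 < a + k by positivity)
      rw [mellinY_add_nat hn ha] at h1
      exact (pos_of_mul_pos_right h1 hM.le).le
    rw [integral_eq_lintegral_of_nonneg_ae _ (by fun_prop), hmomE, ENNReal.toReal_ofReal h0]
    filter_upwards [hQmem] with y hy using pow_nonneg hy.1.le _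
  set p : ℝ → ℝ × ℝ := fun y => (y, y) with hp
  have hpm : Measurable p := by fun_prop
  have key : ((law n a r).map statY).map p = Q.map p := by
    refine ext_of_moments ?_ ?_ fun j k => ?_
    · refine (ae_map_iff hpm.aemeasurable measurableSet_Icc).2 ?_
      refine (ae_map_iff measurable_statY.aemeasurable (hpm measurableSet_Icc)).2 ?_
      filter_upwards [ae_law_pos ha hr] with x hx
      have := statY_mem_Icc hn0 hx
      exact ⟨⟨this.1, this.1⟩, this.2, this.2⟩
    · refine (ae_map_iff hpm.aemeasurable measurableSet_Icc).2 ?_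
      filter_upwards [hQmem] with y hy using ⟨⟨hy.1.le, hy.1.le⟩, hy.2.le, hy.2.le⟩
    · have hmeas : Measurable fun x : ℝ × ℝ => x.1 ^ j * x.2 ^ k := by fun_prop
      rw [integral_map hpm.aemeasurable hmeas.aestronglyMeasurable,
        integral_map hpm.aemeasurable hmeas.aestronglyMeasurable]
      simp_rw [hp, ← pow_add]
      rw [integral_map measurable_statY.aemeasurable (by fun_prop), hmom,
        integral_statY_pow hn0 ha hr]
  have := congrArg (Measure.map Prod.fst) key
  rwa [Measure.map_map measurable_fst hpm, Measure.map_map measurable_fst hpm,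
    show Prod.fst ∘ p = id from rfl, Measure.map_id, Measure.map_id] at this

theorem ae_statY_mem_Ioo (hn : 2 ≤ n) {a r : ℝ} (ha : 0 < a) (hr : 0 < r) :
    ∀ᵐ x ∂law n a r, statY x ∈ Set.Ioo (0 : ℝ) 1 := by
  refine (ae_map_iff measurable_statY.aemeasurable measurableSet_Ioo).1 ?_
  rw [law_map_statY hn ha hr]
  exact (withDensity_absolutelyContinuous _ _).ae_le (ae_restrict_mem measurableSet_Ioo)

theorem lintegral_comp_statY (hn : 2 ≤ n) {a r : ℝ} (ha : 0 < a) (hr : 0 < r) {f : ℝ → ENNReal}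
    (hf : Measurable f) :
    ∫⁻ x, f (statY x) ∂law n a r = ENNReal.ofReal (mellinY n a)⁻¹ *
      ∫⁻ y in Set.Ioo (0 : ℝ) 1, ENNReal.ofReal (densY n a y) * f y := by
  have hM := mellinY_pos hn ha
  rw [← lintegral_map hf measurable_statY, law_map_statY hn ha hr,
    lintegral_withDensity_eq_lintegral_mul _ (by fun_prop) hf,
    ← lintegral_const_mul _ (by fun_prop)]
  refine lintegral_congr fun y => ?_
  rw [Pi.mul_apply, div_eq_inv_mul, ENNReal.ofReal_mul (by positivity), mul_assoc]

/-! ### The derivative of G -/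

/-- The tangent of t^m at p lies below the power at q, and p^m ≥ 0 is dropped. With p = 1 - y and q
= 1 - y/2 this bounds the differentiated series at y by the series at y/2. -/
theorem mul_pow_pred_mul_sub_le {p q : ℝ} (hp : 0 ≤ p) (hpq : p ≤ q) (m : ℕ) :
    m * p ^ (m - 1) * (q - p) ≤ q ^ m := by
  induction m with
  | zero => simp
  | succ m ih =>
    have e : (m : ℝ) * p ^ m = p * (m * p ^ (m - 1)) := by
      rcases m with _ | m
      · simp
      · rw [Nat.add_sub_cancel, pow_succ]; ring
    have h1 : p ^ m ≤ q ^ m := pow_le_pow_left₀ hp hpq m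
    rw [Nat.add_sub_cancel, Nat.cast_succ, pow_succ]
    nlinarith [mul_le_mul_of_nonneg_left ih hp, mul_le_mul_of_nonneg_right h1 (sub_nonneg.2 hpq)]

/-- Minus the termwise derivative of the series `G`. -/
def dG (n : ℕ) (y : ℝ) : ℝ := ∑' m : ℕ, d n m * (m * (1 - y) ^ (m - 1))

theorem summable_dG (hn : 2 ≤ n) {y : ℝ} (hy : y ∈ Set.Ioo (0 : ℝ) 1) :
    Summable fun m : ℕ => d n m * (m * (1 - y) ^ (m - 1)) := by
  have hy2 : y / 2 ∈ Set.Ioo (0 : ℝ) 1 := ⟨by linarith [hy.1], by linarith [hy.2]⟩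
  have hs := (summable_d_mul_pow hn hy2).mul_right (2 / y)
  have hy0 := hy.1
  have hz : 0 < 1 - y := by linarith [hy.2]
  refine Summable.of_nonneg_of_le (fun m => mul_nonneg (d_nonneg hn m) (by positivity))
    (fun m => ?_) hs
  rw [mul_assoc]
  refine mul_le_mul_of_nonneg_left ?_ (d_nonneg hn m)
  have h := mul_pow_pred_mul_sub_le (p := 1 - y) (q := 1 - y / 2) hz.le (by linarith) m
  rw [← div_le_iff₀ (by positivity)]
  refine le_trans (le_of_eq ?_) h
  field_simp
  ring

theorem mul_dG_le (hn : 2 ≤ n) {y : ℝ} (hy : y ∈ Set.Ioo (0 : ℝ) 1) :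
    y * dG n y ≤ 2 * G n (y / 2) := by
  have hy2 : y / 2 ∈ Set.Ioo (0 : ℝ) 1 := ⟨by linarith [hy.1], by linarith [hy.2]⟩
  have hz : 0 < 1 - y := by linarith [hy.2]
  rw [dG, G, ← tsum_mul_left, ← tsum_mul_left]
  refine Summable.tsum_le_tsum (fun m => ?_) ((summable_dG hn hy).mul_left _)
    ((summable_d_mul_pow hn hy2).mul_left _)
  have h := mul_pow_pred_mul_sub_le (p := 1 - y) (q := 1 - y / 2) hz.le (by linarith [hy.1]) m
  nlinarith [mul_le_mul_of_nonneg_left h (d_nonneg hn m)]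

theorem dG_nonneg (hn : 2 ≤ n) {y : ℝ} (hy : y ∈ Set.Ioo (0 : ℝ) 1) : 0 ≤ dG n y :=
  tsum_nonneg fun m => mul_nonneg (d_nonneg hn m)
    (mul_nonneg m.cast_nonneg (pow_nonneg (by linarith [hy.2]) _))

theorem hasDerivAt_G (hn : 2 ≤ n) {y : ℝ} (hy : y ∈ Set.Ioo (0 : ℝ) 1) :
    HasDerivAt (G n) (-dG n y) y := by
  have hy2 : y / 2 ∈ Set.Ioo (0 : ℝ) 1 := ⟨by linarith [hy.1], by linarith [hy.2]⟩
  have hmem : y ∈ Set.Ioo (y / 2) 1 := ⟨by linarith [hy.1], hy.2⟩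
  have h := hasDerivAt_tsum_of_isPreconnected (t := Set.Ioo (y / 2) 1) (y₀ := y) (y := y)
    (g := fun (m : ℕ) y => d n m * (1 - y) ^ m)
    (g' := fun (m : ℕ) y => d n m * (m * (1 - y) ^ (m - 1) * (-1)))
    (summable_dG hn hy2) isOpen_Ioo isPreconnected_Ioo ?_ ?_ hmem (summable_d_mul_pow hn hy) hmem
  · refine h.congr_deriv ?_
    rw [dG, ← tsum_neg]
    congr 1; ext m; ring
  · intro m w _
    exact (((hasDerivAt_id w).const_sub 1).pow m).const_mul (d n m)
  · intro m w hw
    have hz : 0 ≤ 1 - w := by linarith [hw.2]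
    rw [norm_mul, Real.norm_of_nonneg (d_nonneg hn m), norm_mul, norm_neg, norm_one, mul_one,
      Real.norm_of_nonneg (by positivity)]
    refine mul_le_mul_of_nonneg_left (mul_le_mul_of_nonneg_left ?_ m.cast_nonneg) (d_nonneg hn m)
    exact pow_le_pow_left₀ hz (by linarith [hw.1]) _

/-! ### Unbiasedness of u₀(Y) -/

theorem u₀_eq (hn : 2 ≤ n) {y : ℝ} (hy : y ∈ Set.Ioo (0 : ℝ) 1) :
    u₀ n y = ((n : ℝ) - 3) / 2 * (y / (1 - y)) + y * dG n y / G n y := by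
  rw [u₀, (hasDerivAt_G hn hy).deriv]; ring

@[fun_prop]
theorem measurable_u₀ (n : ℕ) : Measurable (u₀ n) := by
  have := measurable_deriv (G n)
  unfold u₀; fun_prop

theorem le_u₀ (hn : 4 ≤ n) {y : ℝ} (hy : y ∈ Set.Ioo (0 : ℝ) 1) :
    ((n : ℝ) - 3) / 2 * (y / (1 - y)) ≤ u₀ n y := by
  have h1 := G_pos (n := n) (by lia) hy
  have h2 := dG_nonneg (n := n) (by lia) hy
  have hy0 := hy.1
  rw [u₀_eq (by lia) hy]
  have : 0 ≤ y * dG n y / G n y := by positivity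
  linarith

theorem u₀_nonneg (hn : 4 ≤ n) {y : ℝ} (hy : y ∈ Set.Ioo (0 : ℝ) 1) : 0 ≤ u₀ n y := by
  have hn' : (4 : ℝ) ≤ n := by exact_mod_cast hn
  refine le_trans (mul_nonneg (by linarith) (div_nonneg hy.1.le (by linarith [hy.2]))) (le_u₀ hn hy)

/-- The product is -y^a times the derivative of (1-y)^{(n-3)/2} G(y), expanded in powers of 1 - y.
-/
theorem densY_mul_u₀ (hn : 4 ≤ n) (a : ℝ) {y : ℝ} (hy : y ∈ Set.Ioo (0 : ℝ) 1) :
    HasSum (fun m : ℕ => d n m * (m + ((n : ℝ) - 3) / 2) *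
      (y ^ (a + 1 - 1) * (1 - y) ^ (m + ((n : ℝ) - 3) / 2 - 1))) (densY n a y * u₀ n y) := by
  have hn2 : 2 ≤ n := by lia
  have hz : 0 < 1 - y := by linarith [hy.2]
  have hy0 := hy.1
  set c : ℝ := ((n : ℝ) - 3) / 2 with hc
  have h := (((summable_d_mul_pow hn2 hy).hasSum.mul_left c).add
    ((summable_dG hn2 hy).hasSum.mul_left (1 - y))).mul_left (y ^ a * (1 - y) ^ (c - 1))
  have e : y ^ a * (1 - y) ^ (c - 1) * (c * ∑' m : ℕ, d n m * (1 - y) ^ m +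
      (1 - y) * ∑' m : ℕ, d n m * (m * (1 - y) ^ (m - 1))) = densY n a y * u₀ n y := by
    have hG := (G_pos hn2 hy).ne'
    rw [u₀_eq hn2 hy, densY, ← hc, show c = (c - 1) + 1 by ring, Real.rpow_add_one hz.ne',
      show c - 1 + 1 - 1 = c - 1 by ring, show a = a - 1 + 1 by ring, Real.rpow_add_one hy0.ne',
      show a - 1 + 1 - 1 = a - 1 by ring]
    change _ * (_ * G n y + (1 - y) * dG n y) = _
    field_simp
  rw [← e]
  refine h.congr_fun fun m => ?_
  rw [add_sub_cancel_right, add_sub_assoc, Real.rpow_add hz, Real.rpow_natCast]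
  rcases m with _ | m
  · simp; ring
  · rw [Nat.add_sub_cancel, pow_succ]; ring

/-- Termwise integration by parts: with c = (n-3)/2, (m+c) B(a+1, m+c) = a B(a, m+c+1). Here n ≥ 4
enters through c > 0, which makes the term m = 0 integrable at 1. -/
theorem lintegral_u₀ (hn : 4 ≤ n) {a r : ℝ} (ha : 0 < a) (hr : 0 < r) :
    ∫⁻ x, ENNReal.ofReal (u₀ n (statY x)) ∂law n a r = ENNReal.ofReal a := by
  have hn2 : 2 ≤ n := by lia
  have hn' : (4 : ℝ) ≤ n := by exact_mod_cast hn
  have hM := mellinY_pos hn2 ha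
  have hc : ∀ m : ℕ, 0 < m + ((n : ℝ) - 3) / 2 := fun m => by
    have : (0 : ℝ) ≤ m := m.cast_nonneg
    linarith
  have hd := d_nonneg hn2
  rw [lintegral_comp_statY hn2 ha hr (f := fun y => ENNReal.ofReal (u₀ n y)) (by fun_prop)]
  have e : ∫⁻ y in Set.Ioo (0 : ℝ) 1, ENNReal.ofReal (densY n a y) * ENNReal.ofReal (u₀ n y) =
      ∫⁻ y in Set.Ioo (0 : ℝ) 1, ∑' m : ℕ, ENNReal.ofReal (d n m * (m + ((n : ℝ) - 3) / 2)) *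
        ENNReal.ofReal (y ^ (a + 1 - 1) * (1 - y) ^ (m + ((n : ℝ) - 3) / 2 - 1)) := by
    refine setLIntegral_congr_fun measurableSet_Ioo fun y hy => ?_
    have h := densY_mul_u₀ hn a hy
    have hz : 0 < 1 - y := by linarith [hy.2]
    have hy0 := hy.1
    have hnn : ∀ m : ℕ, 0 ≤ d n m * (m + ((n : ℝ) - 3) / 2) :=
      fun m => mul_nonneg (hd m) (hc m).le
    simp_rw [← ENNReal.ofReal_mul (hnn _)]
    rw [← ENNReal.ofReal_mul (densY_pos hn2 a hy).le, ← h.tsum_eq,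
      ENNReal.ofReal_tsum_of_nonneg (fun m => mul_nonneg (hnn m) (by positivity)) h.summable]
  rw [e, lintegral_tsum (fun m => by fun_prop)]
  have e2 : ∀ m : ℕ, ∫⁻ y in Set.Ioo (0 : ℝ) 1, ENNReal.ofReal (d n m * (m + ((n : ℝ) - 3) / 2)) *
        ENNReal.ofReal (y ^ (a + 1 - 1) * (1 - y) ^ (m + ((n : ℝ) - 3) / 2 - 1)) =
      ENNReal.ofReal a * ENNReal.ofReal (d n m * beta a (m + ((n : ℝ) - 1) / 2)) := by
    intro m
    rw [lintegral_const_mul _ (by fun_prop),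
      lintegral_rpow_mul_one_sub_rpow (by positivity) (hc m),
      ← ENNReal.ofReal_mul (mul_nonneg (hd m) (hc m).le), ← ENNReal.ofReal_mul ha.le]
    congr 1
    rw [beta, beta, Real.Gamma_add_one ha.ne',
      show (m : ℝ) + ((n : ℝ) - 1) / 2 = (m + ((n : ℝ) - 3) / 2) + 1 by ring,
      Real.Gamma_add_one (hc m).ne', add_right_comm, ← add_assoc]
    ring_nf
  simp_rw [e2]
  rw [ENNReal.tsum_mul_left, tsum_d_mul_beta hn2 ha, ← ENNReal.ofReal_mul ha.le,
    ← ENNReal.ofReal_mul (by positivity)]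
  congr 1
  field_simp

theorem isUnbiased_u₀ (hn : 4 ≤ n) : IsUnbiased n shape fun x => u₀ n (statY x) where
  measurable := by fun_prop
  integrable a r ha hr := by
    have h0 : ∀ᵐ x ∂law n a r, 0 ≤ u₀ n (statY x) := by
      filter_upwards [ae_statY_mem_Ioo (by lia) ha hr] with x hx using u₀_nonneg hn hx
    refine ⟨Measurable.aestronglyMeasurable (by fun_prop), ?_⟩
    rw [hasFiniteIntegral_iff_ofReal h0, lintegral_u₀ hn ha hr]
    exact ENNReal.ofReal_lt_top
  integral_eq a r ha hr := by
    have h0 : ∀ᵐ x ∂law n a r, 0 ≤ u₀ n (statY x) := by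
      filter_upwards [ae_statY_mem_Ioo (by lia) ha hr] with x hx using u₀_nonneg hn hx
    rw [integral_eq_lintegral_of_nonneg_ae h0
      (Measurable.aestronglyMeasurable (by fun_prop)), lintegral_u₀ hn ha hr,
      ENNReal.toReal_ofReal ha.le, shape]

theorem isUMVUE_u₀ (hn : 4 ≤ n) : IsUMVUE n shape fun x => u₀ n (statY x) :=
  ⟨isUnbiased_u₀ hn, fun p => u₀ n p.2, by fun_prop, fun _ _ => rfl⟩

/-! ### Completeness, uniqueness and minimal variance -/

/-- A bounded statistic generating the same `σ`-algebra as `(X, Y)` on the sample space. -/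
def boundedStat (x : Fin n → ℝ) : ℝ × ℝ :=
  ((∏ i, x i) * Real.exp (-statX x), Real.exp (-statX x))

@[fun_prop]
theorem measurable_boundedStat : Measurable (boundedStat (n := n)) := by
  unfold boundedStat; fun_prop

theorem boundedStat_mem_Icc (hn : 0 < n) {x : Fin n → ℝ} (hx : ∀ i, 0 < x i) :
    boundedStat x ∈ Set.Icc (0 : ℝ × ℝ) 1 := by
  have hW : 0 ≤ ∏ i, x i := Finset.prod_nonneg fun i _ => (hx i).le
  have hX := statX_pos hn hx
  have e : (∏ i, x i) * Real.exp (-statX x) = ∏ i, x i * Real.exp (-x i) := by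
    rw [Finset.prod_mul_distrib, ← Real.exp_sum, Finset.sum_neg_distrib, statX]
  refine ⟨⟨mul_nonneg hW (Real.exp_pos _).le, (Real.exp_pos _).le⟩, ?_, ?_⟩
  · change (∏ i, x i) * Real.exp (-statX x) ≤ 1
    rw [e]
    refine Finset.prod_le_one (fun i _ => mul_nonneg (hx i).le (Real.exp_pos _).le) fun i _ => ?_
    rw [Real.exp_neg, ← div_eq_mul_inv, div_le_one (Real.exp_pos _)]
    linarith [Real.add_one_le_exp (x i)]
  · change Real.exp (-statX x) ≤ 1
    simpa using hX.le

/-- Completeness of the statistic `(X, Y)`. -/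
theorem condExp_boundedStat_eq_zero (hn : 0 < n) {D : (Fin n → ℝ) → ℝ}
    (hD : ∀ a r : ℝ, 0 < a → 0 < r → Integrable D (law n a r))
    (h0 : ∀ a r : ℝ, 0 < a → 0 < r → ∫ x, D x ∂law n a r = 0) {a r : ℝ} (ha : 0 < a)
    (hr : 0 < r) :
    (law n a r)[D | MeasurableSpace.comap boundedStat inferInstance] =ᵐ[law n a r] 0 := by
  have := isProbabilityMeasure_law (n := n) ha hr
  refine condExp_eq_zero_of_moments (hD a r ha hr) measurable_boundedStat ?_ fun j k => ?_
  · filter_upwards [ae_law_pos ha hr] with x hx using boundedStat_mem_Icc hn hx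
  -- Raising the shape by j and the rate by j + k gives exactly the weight (∏ xᵢ)^j e^{-(j+k)X}, the
  -- required monomial in `boundedStat`.
  · have ht : (0 : ℝ) ≤ (j + k : ℕ) := by positivity
    have h := integral_law_tilt (n := n) ha hr ht j D
    rw [h0 _ _ (by positivity) (by positivity)] at h
    have hC := tiltConst_pos ha hr ht j
    have h2 := (mul_eq_zero.1 h.symm).resolve_left (by positivity)
    rw [← h2]
    congr 1; ext x
    have e : Real.exp (-(((j + k : ℕ) : ℝ) * statX x)) =
        Real.exp (-statX x) ^ j * Real.exp (-statX x) ^ k := by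
      rw [← pow_add, ← Real.exp_nat_mul]; ring_nf
    rw [e, boundedStat, mul_pow]
    ring

/-- The statistic `(X, Y)` as a function of `boundedStat`. -/
def statOfBounded (n : ℕ) (q : ℝ × ℝ) : ℝ × ℝ :=
  (-Real.log q.2, n ^ n * (q.1 / q.2) / (-Real.log q.2) ^ n)

@[fun_prop]
theorem measurable_statOfBounded (n : ℕ) : Measurable (statOfBounded n) := by
  unfold statOfBounded; fun_prop

theorem statOfBounded_boundedStat (hn : 0 < n) {x : Fin n → ℝ} (hx : ∀ i, 0 < x i) :
    statOfBounded n (boundedStat x) = (statX x, statY x) := by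
  have h := (Real.exp_pos (-statX x)).ne'
  simp [statOfBounded, boundedStat, statY_eq hn hx, mul_div_assoc, h]

theorem condExp_comp_stat (hn : 0 < n) {u : ℝ × ℝ → ℝ} (hu : Measurable u) {a r : ℝ} (ha : 0 < a)
    (hr : 0 < r) {S : (Fin n → ℝ) → ℝ} (hS : Integrable S (law n a r))
    (hSu : ∀ x : Fin n → ℝ, (∀ i, 0 < x i) → S x = u (statX x, statY x)) :
    (law n a r)[S | MeasurableSpace.comap boundedStat inferInstance] =ᵐ[law n a r] S := by
  have := isProbabilityMeasure_law (n := n) ha hr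
  have hae : S =ᵐ[law n a r] fun x => u (statOfBounded n (boundedStat x)) := by
    filter_upwards [ae_law_pos ha hr] with x hx
    rw [hSu x hx, statOfBounded_boundedStat hn hx]
  have hm : StronglyMeasurable[MeasurableSpace.comap boundedStat inferInstance]
      fun x : Fin n → ℝ => u (statOfBounded n (boundedStat x)) :=
    ((hu.comp (measurable_statOfBounded n)).comp (comap_measurable boundedStat)).stronglyMeasurable
  refine (condExp_congr_ae hae).trans ?_
  rw [condExp_of_stronglyMeasurable measurable_boundedStat.comap_le hm (hS.congr hae)]
  exact hae.symm

/-- Any unbiased estimator has a given unbiased function of `(X, Y)` as its conditional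
expectation. -/
theorem condExp_unbiased (hn : 0 < n) {h : ℝ → ℝ → ℝ} {S T : (Fin n → ℝ) → ℝ}
    (hS : IsUMVUE n h S) (hT : IsUnbiased n h T) {a r : ℝ} (ha : 0 < a) (hr : 0 < r) :
    (law n a r)[T | MeasurableSpace.comap boundedStat inferInstance] =ᵐ[law n a r] S := by
  obtain ⟨u, hu, hSu⟩ := hS.factors
  have h1 := condExp_boundedStat_eq_zero hn (D := T - S)
    (fun a r ha hr => (hT.integrable a r ha hr).sub (hS.unbiased.integrable a r ha hr))
    (fun a r ha hr => by
      rw [integral_sub' (hT.integrable a r ha hr) (hS.unbiased.integrable a r ha hr),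
        hT.integral_eq a r ha hr, hS.unbiased.integral_eq a r ha hr, sub_self]) ha hr
  have h2 := condExp_sub (hT.integrable a r ha hr) (hS.unbiased.integrable a r ha hr)
    (MeasurableSpace.comap boundedStat inferInstance)
  have h3 := condExp_comp_stat hn hu ha hr (hS.unbiased.integrable a r ha hr) hSu
  filter_upwards [h1, h2, h3] with x h1 h2 h3
  rw [h1, Pi.sub_apply, h3, Pi.zero_apply] at h2
  linarith

theorem IsUMVUE.ae_eq (hn : 0 < n) {h : ℝ → ℝ → ℝ} {S T : (Fin n → ℝ) → ℝ}
    (hS : IsUMVUE n h S) (hT : IsUMVUE n h T) {a r : ℝ} (ha : 0 < a) (hr : 0 < r) :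
    T =ᵐ[law n a r] S := by
  obtain ⟨u, hu, hTu⟩ := hT.factors
  exact (condExp_comp_stat hn hu ha hr (hT.unbiased.integrable a r ha hr) hTu).symm.trans
    (condExp_unbiased hn hS hT.unbiased ha hr)

/-- Stated in `ENNReal`, so that the L² contraction of conditional expectation also covers infinite
variances. -/
theorem evariance_eq_eLpNorm_sq {Ω : Type*} [MeasurableSpace Ω] (μ : Measure Ω) (f : Ω → ℝ) :
    evariance f μ = eLpNorm (fun x => f x - ∫ y, f y ∂μ) 2 μ ^ 2 := by
  have h := eLpNorm_nnreal_pow_eq_lintegral (μ := μ) (p := 2) (f := fun x => f x - ∫ y, f y ∂μ)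
    (by norm_num)
  simp only [NNReal.coe_ofNat, ENNReal.coe_ofNat, ENNReal.rpow_ofNat] at h
  rw [h, evariance]

/-- Rao–Blackwell: `S` minus the common mean is the conditional expectation of `T` minus that mean.
-/
theorem IsUMVUE.evariance_le (hn : 0 < n) {h : ℝ → ℝ → ℝ} {S T : (Fin n → ℝ) → ℝ}
    (hS : IsUMVUE n h S) (hT : IsUnbiased n h T) {a r : ℝ} (ha : 0 < a) (hr : 0 < r) :
    evariance S (law n a r) ≤ evariance T (law n a r) := by
  have := isProbabilityMeasure_law (n := n) ha hr
  rw [evariance_eq_eLpNorm_sq, evariance_eq_eLpNorm_sq, hT.integral_eq a r ha hr,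
    hS.unbiased.integral_eq a r ha hr]
  have h1 := condExp_unbiased hn hS hT ha hr
  have h2 := condExp_sub (hT.integrable a r ha hr) (integrable_const (h a r))
    (MeasurableSpace.comap boundedStat inferInstance)
  have h3 : (law n a r)[fun x => T x - h a r | MeasurableSpace.comap boundedStat inferInstance]
      =ᵐ[law n a r] fun x => S x - h a r := by
    refine h2.trans ?_
    filter_upwards [h1] with x h1
    rw [Pi.sub_apply, h1, condExp_const measurable_boundedStat.comap_le]
  rw [← eLpNorm_congr_ae h3]
  gcongr
  exact eLpNorm_condExp_le_eLpNorm _ (by norm_num)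

/-! ### Finiteness of the variance -/

theorem evariance_u₀_lt_top_iff (hn : 4 ≤ n) {a r : ℝ} (ha : 0 < a) (hr : 0 < r) :
    evariance (fun x => u₀ n (statY x)) (law n a r) < ⊤ ↔
      ∫⁻ y in Set.Ioo (0 : ℝ) 1, ENNReal.ofReal (densY n a y * u₀ n y ^ 2) < ⊤ := by
  have hn2 : 2 ≤ n := by lia
  have := isProbabilityMeasure_law (n := n) ha hr
  have hm : AEStronglyMeasurable (fun x : Fin n → ℝ => u₀ n (statY x)) (law n a r) :=
    Measurable.aestronglyMeasurable (by fun_prop)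
  have hm2 : AEStronglyMeasurable (fun x : Fin n → ℝ => u₀ n (statY x) ^ 2) (law n a r) :=
    Measurable.aestronglyMeasurable (by fun_prop)
  have hM : 0 < (mellinY n a)⁻¹ := inv_pos.2 (mellinY_pos hn2 ha)
  have e : ∫⁻ y in Set.Ioo (0 : ℝ) 1, ENNReal.ofReal (densY n a y * u₀ n y ^ 2) =
      ∫⁻ y in Set.Ioo (0 : ℝ) 1, ENNReal.ofReal (densY n a y) * ENNReal.ofReal (u₀ n y ^ 2) :=
    setLIntegral_congr_fun measurableSet_Ioo fun y hy =>
      ENNReal.ofReal_mul (densY_pos hn2 a hy).le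
  rw [evariance_lt_top_iff_memLp hm, memLp_two_iff_integrable_sq hm, Integrable,
    and_iff_right hm2,
    hasFiniteIntegral_iff_ofReal (Filter.Eventually.of_forall fun x => sq_nonneg _),
    lintegral_comp_statY hn2 ha hr (f := fun y => ENNReal.ofReal (u₀ n y ^ 2)) (by fun_prop), ← e]
  constructor
  · intro h
    exact ENNReal.lt_top_of_mul_ne_top_right h.ne (by simpa using hM)
  · exact ENNReal.mul_lt_top ENNReal.ofReal_lt_top

theorem lintegral_inv_one_sub_eq_top :
    ∫⁻ y in Set.Ioo (1 / 2 : ℝ) 1, ENNReal.ofReal (1 - y)⁻¹ = ⊤ := by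
  by_contra h
  have h0 : ∀ᵐ y ∂volume.restrict (Set.Ioo (1 / 2 : ℝ) 1), 0 ≤ (1 - y)⁻¹ := by
    filter_upwards [ae_restrict_mem measurableSet_Ioo] with y hy
    exact inv_nonneg.2 (by linarith [hy.2])
  have hi : IntegrableOn (fun y : ℝ => (1 - y)⁻¹) (Set.Ioo (1 / 2 : ℝ) 1) :=
    ⟨Measurable.aestronglyMeasurable (by fun_prop),
      (hasFiniteIntegral_iff_ofReal h0).2 (lt_top_iff_ne_top.2 h)⟩
  have hi2 : IntervalIntegrable (fun y : ℝ => (y - 1)⁻¹) volume (1 / 2) 1 := by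
    rw [intervalIntegrable_iff_integrableOn_Ioo_of_le (by norm_num)]
    refine hi.neg.congr (Filter.Eventually.of_forall fun y => ?_)
    simp only [Pi.neg_apply]
    rw [← inv_neg, neg_sub]
  rw [intervalIntegrable_sub_inv_iff] at hi2
  rcases hi2 with h | h
  · norm_num at h
  · exact h Set.right_mem_uIcc

theorem evariance_u₀_eq_top (hn : 4 ≤ n) (hn5 : n ≤ 5) {a r : ℝ} (ha : 0 < a) (hr : 0 < r) :
    ¬evariance (fun x => u₀ n (statY x)) (law n a r) < ⊤ := by
  have hn2 : 2 ≤ n := by lia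
  rw [evariance_u₀_lt_top_iff hn ha hr, not_lt, top_le_iff]
  have hn4' : (4 : ℝ) ≤ n := by exact_mod_cast hn
  have hn5' : (n : ℝ) ≤ 5 := by exact_mod_cast hn5
  have hd := d_zero_pos hn2
  set c : ℝ := ((n : ℝ) - 3) / 2 with hc
  have hc0 : 0 < c := by rw [hc]; linarith
  have hc1 : c ≤ 1 := by rw [hc]; linarith
  -- On (1/2, 1) the integrand is at least K/(1-y): bound y^{a+1} by its value at 1/2, G by d_0, u₀
  -- by its first summand, and (1-y)^c by 1 - y, using c ≤ 1.
  set K : ℝ := (1 / 2) ^ (a + 1) * d n 0 * c ^ 2 with hK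
  have hK0 : 0 < K := by positivity
  rw [← top_le_iff]
  calc (⊤ : ENNReal)
      = ENNReal.ofReal K * ∫⁻ y in Set.Ioo (1 / 2 : ℝ) 1, ENNReal.ofReal (1 - y)⁻¹ := by
        rw [lintegral_inv_one_sub_eq_top, ENNReal.mul_top (by simpa using hK0)]
    _ = ∫⁻ y in Set.Ioo (1 / 2 : ℝ) 1, ENNReal.ofReal K * ENNReal.ofReal (1 - y)⁻¹ := by
        rw [lintegral_const_mul _ (by fun_prop)]
    _ ≤ ∫⁻ y in Set.Ioo (1 / 2 : ℝ) 1, ENNReal.ofReal (densY n a y * u₀ n y ^ 2) := by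
        refine setLIntegral_mono (by fun_prop) fun y hy => ?_
        have hy' : y ∈ Set.Ioo (0 : ℝ) 1 := ⟨by linarith [hy.1], hy.2⟩
        have hy0 : 0 < y := hy'.1
        have hz : 0 < 1 - y := by linarith [hy.2]
        rw [← ENNReal.ofReal_mul hK0.le]
        refine ENNReal.ofReal_le_ofReal ?_
        have h1 : (c * (y / (1 - y))) ^ 2 ≤ u₀ n y ^ 2 :=
          pow_le_pow_left₀ (by positivity) (le_u₀ hn hy') 2
        have h2 : y ^ (a - 1) * ((1 - y) ^ (1 : ℝ) * d n 0) ≤ densY n a y := by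
          rw [densY, ← hc]
          have h3 := Real.rpow_le_rpow_of_exponent_ge hz (by linarith) hc1
          have h4 := d_zero_le_G hn2 hy'
          gcongr
        have h5 : (1 / 2 : ℝ) ^ (a + 1) ≤ y ^ (a + 1) :=
          Real.rpow_le_rpow (by norm_num) hy.1.le (by positivity)
        have h6 : y ^ (a + 1) = y ^ (a - 1) * y ^ 2 := by
          rw [← Real.rpow_natCast, ← Real.rpow_add hy0]; congr 1; push_cast; ring
        calc K * (1 - y)⁻¹ ≤ y ^ (a + 1) * d n 0 * c ^ 2 * (1 - y)⁻¹ := by rw [hK]; gcongr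
          _ = y ^ (a - 1) * ((1 - y) ^ (1 : ℝ) * d n 0) * (c * (y / (1 - y))) ^ 2 := by
            rw [h6, Real.rpow_one]; field_simp
          _ ≤ _ := by
            refine mul_le_mul h2 h1 (by positivity) (densY_pos hn2 a hy').le
    _ ≤ _ := lintegral_mono_set (Set.Ioo_subset_Ioo_left (by norm_num))

theorem G_antitoneOn (hn : 2 ≤ n) : AntitoneOn (G n) (Set.Ioo 0 1) := by
  intro y hy y' hy' h
  refine Summable.tsum_le_tsum (fun m => ?_) (summable_d_mul_pow hn hy') (summable_d_mul_pow hn hy)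
  exact mul_le_mul_of_nonneg_left (pow_le_pow_left₀ (by linarith [hy'.2]) (by linarith) _)
    (d_nonneg hn m)

/-- `G` grows slower than any negative power at the origin. -/
theorem exists_G_half_le (hn : 3 ≤ n) {ε : ℝ} (hε : 0 < ε) (hε1 : ε ≤ 1) :
    ∃ C : ℝ, 0 < C ∧ ∀ y ∈ Set.Ioo (0 : ℝ) 1, G n (y / 2) ≤ C * y ^ (-ε) := by
  have hn2 : 2 ≤ n := by lia
  have hn' : (3 : ℝ) ≤ n := by exact_mod_cast hn
  have hM := mellinY_pos hn2 hε
  set c : ℝ := ((n : ℝ) - 3) / 2 with hc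
  have hc0 : 0 ≤ c := by rw [hc]; linarith
  have hhalf : (0 : ℝ) < (1 / 2) ^ c := by positivity
  refine ⟨mellinY n ε * ((1 / 2) ^ c)⁻¹ * 2 ^ ε, by positivity, fun y hy => ?_⟩
  have hy0 := hy.1
  set w := y / 2 with hw
  have hw0 : 0 < w := by positivity
  have hw1 : w < 1 / 2 := by rw [hw]; linarith [hy.2]
  have hwm : w ∈ Set.Ioo (0 : ℝ) 1 := ⟨hw0, by linarith⟩
  have hG := G_pos hn2 hwm
  -- The mass of `densY n ε` on (0, w) is at least w times a lower bound for it there; both t^{ε-1}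
  -- (as ε ≤ 1) and G decrease.
  have key : w ^ ε * (1 / 2) ^ c * G n w ≤ mellinY n ε := by
    rw [← ENNReal.ofReal_le_ofReal_iff hM.le, ← lintegral_densY hn2 hε]
    calc ENNReal.ofReal (w ^ ε * (1 / 2) ^ c * G n w)
        = ∫⁻ _ in Set.Ioo (0 : ℝ) w, ENNReal.ofReal (w ^ (ε - 1) * ((1 / 2) ^ c * G n w)) := by
          rw [setLIntegral_const, Real.volume_Ioo, sub_zero, ← ENNReal.ofReal_mul (by positivity)]
          congr 1
          rw [Real.rpow_sub_one hw0.ne']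
          field_simp
      _ ≤ ∫⁻ t in Set.Ioo (0 : ℝ) w, ENNReal.ofReal (densY n ε t) := by
          refine setLIntegral_mono (by fun_prop) fun t ht => ENNReal.ofReal_le_ofReal ?_
          have ht0 := ht.1
          have h1 : w ^ (ε - 1) ≤ t ^ (ε - 1) :=
            Real.rpow_le_rpow_of_nonpos ht.1 ht.2.le (by linarith)
          have h2 : (1 / 2 : ℝ) ^ c ≤ (1 - t) ^ c :=
            Real.rpow_le_rpow (by norm_num) (by linarith [ht.2]) hc0
          have h3 : G n w ≤ G n t := G_antitoneOn hn2 ⟨ht.1, by linarith [ht.2]⟩ hwm ht.2.le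
          have h4 : 0 ≤ (1 - t) ^ c := hhalf.le.trans h2
          rw [densY, ← hc]
          gcongr
      _ ≤ _ := lintegral_mono_set (Set.Ioo_subset_Ioo_right (by linarith))
  have e : y ^ (-ε) * 2 ^ ε = (w ^ ε)⁻¹ := by
    rw [hw, Real.div_rpow hy0.le (by norm_num), Real.rpow_neg hy0.le, inv_div]
    field_simp
  have hwε : 0 < w ^ ε := by positivity
  calc G n w = (w ^ ε * (1 / 2) ^ c * G n w) * (w ^ ε)⁻¹ * ((1 / 2) ^ c)⁻¹ := by field_simp
    _ ≤ mellinY n ε * (w ^ ε)⁻¹ * ((1 / 2) ^ c)⁻¹ := by gcongr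
    _ = _ := by rw [← e]; ring

theorem evariance_u₀_lt_top (hn : 6 ≤ n) {a r : ℝ} (ha : 0 < a) (hr : 0 < r) :
    evariance (fun x => u₀ n (statY x)) (law n a r) < ⊤ := by
  have hn2 : 2 ≤ n := by lia
  rw [evariance_u₀_lt_top_iff (by lia) ha hr]
  have hn' : (6 : ℝ) ≤ n := by exact_mod_cast hn
  -- One factor y^{-ε} comes from the density and two from u₀², so a - 3ε must be positive.
  set ε : ℝ := min 1 (a / 4) with hε
  have hε0 : 0 < ε := lt_min one_pos (by positivity)
  have hεa : ε ≤ a / 4 := min_le_right _ _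
  obtain ⟨C, hC, hGC⟩ := exists_G_half_le (n := n) (by lia) hε0 (min_le_left _ _)
  set c : ℝ := ((n : ℝ) - 3) / 2 with hc
  have hc1 : 1 < c := by rw [hc]; linarith
  have hc0 : 0 < c := by linarith
  have hd := d_zero_pos hn2
  set K : ℝ := 2 * C / d n 0 with hK
  have hK0 : 0 < K := by positivity
  have hbound : ∀ y ∈ Set.Ioo (0 : ℝ) 1, densY n a y * u₀ n y ^ 2 ≤
      (C * (2 * c ^ 2)) * (y ^ (a - ε - 1) * (1 - y) ^ (c - 1 - 1)) +
      (C * (2 * K ^ 2)) * (y ^ (a - 3 * ε - 1) * (1 - y) ^ (c + 1 - 1)) := by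
    intro y hy
    have hy0 := hy.1
    have hz : 0 < 1 - y := by linarith [hy.2]
    have hy2 : y / 2 ∈ Set.Ioo (0 : ℝ) 1 := ⟨by linarith [hy.1], by linarith [hy.2]⟩
    have hG := G_pos hn2 hy
    have h1 : G n y ≤ C * y ^ (-ε) :=
      (G_antitoneOn hn2 hy2 hy (by linarith)).trans (hGC y hy)
    have h2 : y * dG n y / G n y ≤ K * y ^ (-ε) := by
      have h3 : y * dG n y ≤ 2 * (C * y ^ (-ε)) :=
        (mul_dG_le hn2 hy).trans (mul_le_mul_of_nonneg_left (hGC y hy) (by norm_num))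
      calc y * dG n y / G n y ≤ 2 * (C * y ^ (-ε)) / d n 0 :=
            div_le_div₀ (by positivity) h3 hd (d_zero_le_G hn2 hy)
        _ = _ := by rw [hK]; ring
    have h4 : u₀ n y ≤ c * (1 - y)⁻¹ + K * y ^ (-ε) := by
      rw [u₀_eq hn2 hy, ← hc]
      have : y / (1 - y) ≤ (1 - y)⁻¹ := by
        rw [div_eq_mul_inv]
        exact mul_le_of_le_one_left (by positivity) hy.2.le
      gcongr
    have h5 : u₀ n y ^ 2 ≤ 2 * c ^ 2 * ((1 - y)⁻¹) ^ 2 + 2 * K ^ 2 * (y ^ (-ε)) ^ 2 := by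
      have := pow_le_pow_left₀ (u₀_nonneg (by lia) hy) h4 2
      nlinarith [sq_nonneg (c * (1 - y)⁻¹ - K * y ^ (-ε))]
    have h6 : densY n a y ≤ y ^ (a - 1) * ((1 - y) ^ c * (C * y ^ (-ε))) := by
      rw [densY, ← hc]; gcongr
    calc densY n a y * u₀ n y ^ 2
        ≤ (y ^ (a - 1) * ((1 - y) ^ c * (C * y ^ (-ε)))) *
          (2 * c ^ 2 * ((1 - y)⁻¹) ^ 2 + 2 * K ^ 2 * (y ^ (-ε)) ^ 2) :=
          mul_le_mul h6 h5 (sq_nonneg _) (by positivity)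
      _ = _ := by
          have e1 : y ^ (a - ε - 1) = y ^ (a - 1) * y ^ (-ε) := by
            rw [← Real.rpow_add hy0]; ring_nf
          have e2 : y ^ (a - 3 * ε - 1) = y ^ (a - 1) * y ^ (-ε) * (y ^ (-ε)) ^ 2 := by
            rw [pow_two, ← Real.rpow_add hy0, ← Real.rpow_add hy0, ← Real.rpow_add hy0]; ring_nf
          have e3 : (1 - y) ^ (c - 1 - 1) = (1 - y) ^ c * ((1 - y)⁻¹) ^ 2 := by
            rw [Real.rpow_sub_one hz.ne', Real.rpow_sub_one hz.ne']; field_simp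
          rw [e1, e2, e3, add_sub_cancel_right]
          ring
  refine lt_of_le_of_lt (setLIntegral_mono (by fun_prop) fun y hy =>
    (ENNReal.ofReal_le_ofReal (hbound y hy)).trans ENNReal.ofReal_add_le) ?_
  rw [lintegral_add_left (by fun_prop)]
  have hfin : ∀ A p q : ℝ, 0 ≤ A → 0 < p → 0 < q →
      ∫⁻ y in Set.Ioo (0 : ℝ) 1, ENNReal.ofReal (A * (y ^ (p - 1) * (1 - y) ^ (q - 1))) < ⊤ := by
    intro A p q hA hp hq
    simp_rw [ENNReal.ofReal_mul hA]
    rw [lintegral_const_mul _ (by fun_prop), lintegral_rpow_mul_one_sub_rpow hp hq]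
    exact ENNReal.mul_lt_top ENNReal.ofReal_lt_top ENNReal.ofReal_lt_top
  exact ENNReal.add_lt_top.2 ⟨hfin _ _ _ (by positivity) (by linarith) (by linarith),
    hfin _ _ _ (by positivity) (by linarith) (by linarith)⟩

/-! ### No unbiased estimator for n = 2, 3 -/

/-- Completeness of the sum of the data when the shape is fixed. -/
theorem integral_mul_comp_statX_eq_zero (hn : 0 < n) {a : ℝ} (ha : 0 < a) {D : (Fin n → ℝ) → ℝ}
    (hD : ∀ r : ℝ, 0 < r → Integrable D (law n a r))
    (h0 : ∀ r : ℝ, 0 < r → ∫ x, D x ∂law n a r = 0) {r : ℝ} (hr : 0 < r) {φ : ℝ → ℝ}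
    (hφ : Measurable φ) (hint : Integrable (fun x => D x * φ (statX x)) (law n a r)) :
    ∫ x, D x * φ (statX x) ∂law n a r = 0 := by
  have := isProbabilityMeasure_law (n := n) ha hr
  set p : (Fin n → ℝ) → ℝ × ℝ := fun x => (Real.exp (-statX x), Real.exp (-statX x)) with hp
  have hpm : Measurable p := by fun_prop
  have hcond : (law n a r)[D | MeasurableSpace.comap p inferInstance] =ᵐ[law n a r] 0 := by
    refine condExp_eq_zero_of_moments (hD r hr) hpm ?_ fun j k => ?_
    · filter_upwards [ae_law_pos ha hr] with x hx
      have hX := statX_pos hn hx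
      refine ⟨⟨(Real.exp_pos _).le, (Real.exp_pos _).le⟩, ?_⟩
      constructor <;> simpa [hp] using hX.le
    · have ht : (0 : ℝ) ≤ (j + k : ℕ) := by positivity
      have h := integral_law_tilt (n := n) ha hr ht 0 D
      rw [Nat.cast_zero, add_zero, h0 _ (by positivity)] at h
      have hC := tiltConst_pos ha hr ht 0
      have h2 := (mul_eq_zero.1 h.symm).resolve_left (by positivity)
      rw [← h2]
      congr 1; ext x
      rw [hp, ← pow_add, ← Real.exp_nat_mul, mul_comm]
      ring_nf
  have e : (fun x : Fin n → ℝ => φ (statX x)) = (fun q : ℝ × ℝ => φ (-Real.log q.1)) ∘ p := by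
    ext x; simp [hp]
  have hg : StronglyMeasurable[MeasurableSpace.comap p inferInstance]
      fun x : Fin n → ℝ => φ (statX x) := by
    rw [e]
    exact ((show Measurable fun q : ℝ × ℝ => φ (-Real.log q.1) by fun_prop).comp
      (comap_measurable p)).stronglyMeasurable
  have h1 := condExp_mul_of_stronglyMeasurable_right (μ := law n a r) hg hint (hD r hr)
  rw [← integral_condExp hpm.comap_le]
  refine (integral_congr_ae (h1.trans ?_)).trans (integral_zero _ _)
  filter_upwards [hcond] with x hx
  simp [hx]

theorem exists_law_statX_ge_ne_zero (hn : 0 < n) {a r : ℝ} (ha : 0 < a) (hr : 0 < r) :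
    ∃ ε : ℝ, 0 < ε ∧ law n a r {x | ε ≤ statX x} ≠ 0 := by
  have := isProbabilityMeasure_law (n := n) ha hr
  by_contra! hcon
  have h : ∀ m : ℕ, ∀ᵐ x ∂law n a r, ¬(1 / ((m : ℝ) + 1) ≤ statX x) := fun m => by
    rw [ae_iff]; simpa using hcon _ (by positivity)
  obtain ⟨x, hx, hx'⟩ := ((ae_law_pos ha hr).and (ae_all_iff.2 h)).exists
  obtain ⟨m, hm⟩ := exists_nat_one_div_lt (statX_pos hn hx)
  exact hx' m hm.le

/-- The moments decay like k^{-(n-1)/2}, no faster than 1/k for n ≤ 3. The comparison sequence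
(2/3)/(k+2/3) has ratios at most those of the moments and starts at the same value 1. -/
theorem le_succ_mul_momentY (hn : n = 2 ∨ n = 3) (k : ℕ) :
    2 / 3 ≤ (1 + (k : ℝ)) * momentY n 1 k := by
  have hn0 : 0 < n := by lia
  have key : (2 / 3) / ((k : ℝ) + 2 / 3) ≤ momentY n 1 k := by
    induction k with
    | zero => rw [momentY_zero n hn0 one_pos]; norm_num
    | succ k ih =>
      rw [momentY_succ hn0 one_pos]
      have hk : (0 : ℝ) ≤ k := k.cast_nonneg
      have hratio : ((k : ℝ) + 2 / 3) / (k + 1 + 2 / 3) ≤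
          ∏ j ∈ Finset.range n, (1 + (k : ℝ)) / (1 + k + j / n) := by
        rcases hn with rfl | rfl
        all_goals
          simp only [Finset.prod_range_succ, Finset.prod_range_zero]
          push_cast
          rw [div_le_iff₀ (by positivity)]
          field_simp
          nlinarith [pow_nonneg hk 2, pow_nonneg hk 3]
      calc (2 / 3) / (((k + 1 : ℕ) : ℝ) + 2 / 3)
          = (2 / 3) / ((k : ℝ) + 2 / 3) * (((k : ℝ) + 2 / 3) / (k + 1 + 2 / 3)) := by
            push_cast; field_simp
        _ ≤ _ := mul_le_mul ih hratio (by positivity) (le_trans (by positivity) ih)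
  have h1 : (2 / 3 : ℝ) ≤ (1 + k) * ((2 / 3) / ((k : ℝ) + 2 / 3)) := by
    have hk : (0 : ℝ) ≤ k := k.cast_nonneg
    rw [mul_div_assoc', le_div_iff₀ (by positivity)]
    nlinarith
  exact h1.trans (mul_le_mul_of_nonneg_left key (by positivity))

/-- Basu's argument: the mean of Y^k at shape 1 is free of the rate, so completeness of X decouples
Y^k from functions of X. -/
theorem integral_statY_pow_mul_indicator (hn : 2 ≤ n) (ε : ℝ) (k : ℕ) :
    ∫ x, statY x ^ k * (Set.Ici ε).indicator 1 (statX x) ∂law n 1 1 =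
      momentY n 1 k * ∫ x, (Set.Ici ε).indicator 1 (statX x) ∂law n 1 1 := by
  have hn0 : 0 < n := by lia
  have hYint : ∀ r : ℝ, 0 < r → Integrable (fun x => statY x ^ k) (law n 1 r) := fun r hr => by
    have := isProbabilityMeasure_law (n := n) one_pos hr
    refine Integrable.of_bound (Measurable.aestronglyMeasurable (by fun_prop)) 1 ?_
    filter_upwards [ae_law_pos one_pos hr] with x hx
    have hY := statY_mem_Icc hn0 hx
    rw [norm_pow, Real.norm_of_nonneg hY.1]
    exact pow_le_one₀ hY.1 hY.2
  have := isProbabilityMeasure_law (n := n) one_pos one_pos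
  have hφ : Measurable ((Set.Ici ε).indicator (1 : ℝ → ℝ)) :=
    measurable_one.indicator measurableSet_Ici
  have hφb : ∀ t : ℝ, ‖(Set.Ici ε).indicator (1 : ℝ → ℝ) t‖ ≤ 1 := fun t =>
    (norm_indicator_le_norm_self _ _).trans (by simp)
  have hbdd : ∀ f : (Fin n → ℝ) → ℝ, Integrable f (law n 1 1) →
      Integrable (fun x => f x * (Set.Ici ε).indicator (1 : ℝ → ℝ) (statX x)) (law n 1 1) :=
    fun f hf => hf.mul_bdd (c := 1) (hφ.comp measurable_statX).aestronglyMeasurable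
      (Filter.Eventually.of_forall fun x => hφb _)
  have h := integral_mul_comp_statX_eq_zero hn0 one_pos
    (D := fun x => statY x ^ k - momentY n 1 k)
    (fun r hr => by
      have := isProbabilityMeasure_law (n := n) one_pos hr
      exact (hYint r hr).sub (integrable_const _))
    (fun r hr => by
      have := isProbabilityMeasure_law (n := n) one_pos hr
      rw [integral_sub (hYint r hr) (integrable_const _), integral_statY_pow hn0 one_pos hr]
      simp) one_pos hφ (hbdd _ ((hYint 1 one_pos).sub (integrable_const _)))
  simp only [sub_mul] at h
  rw [integral_sub (hbdd _ (hYint 1 one_pos)) (hbdd _ (integrable_const _)), integral_const_mul,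
    sub_eq_zero] at h
  exact h

/-- At the fixed shape 1 + k, completeness of X allows T to be replaced by 1 + k against bounded
functions of X. Tilting back to shape 1 carries this to the single law on which k varies only
through Y^k. -/
theorem IsUnbiased.integral_mul_statY_pow (hn : 2 ≤ n) {T : (Fin n → ℝ) → ℝ}
    (hT : IsUnbiased n shape T) {ε : ℝ} (hε : 0 < ε) (k : ℕ) :
    ∫ x, T x * (statY x ^ k * (Set.Ici ε).indicator 1 (statX x)) ∂law n 1 1 =
      (1 + k) * ∫ x, statY x ^ k * (Set.Ici ε).indicator 1 (statX x) ∂law n 1 1 := by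
  have hn0 : 0 < n := by lia
  have ha : (0 : ℝ) < 1 + k := by positivity
  have := isProbabilityMeasure_law (n := n) ha one_pos
  -- The factor t^{-nk} turns the tilt (∏ xᵢ)^k into a multiple of Y^k; the cutoff at ε keeps the
  -- weight bounded, so that its product with T is integrable.
  set φ : ℝ → ℝ := fun t => (t ^ (n * k))⁻¹ * (Set.Ici ε).indicator 1 t with hφ_def
  have hind : Measurable ((Set.Ici ε).indicator (1 : ℝ → ℝ)) :=
    measurable_one.indicator measurableSet_Ici
  have hφ : Measurable φ := by fun_prop
  have hφb : ∀ t : ℝ, ‖φ t‖ ≤ (ε ^ (n * k))⁻¹ := by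
    intro t
    by_cases ht : t ∈ Set.Ici ε
    · have ht' : ε ≤ t := ht
      have ht0 : 0 < t := hε.trans_le ht'
      rw [hφ_def]
      simp only [Set.indicator_of_mem ht, Pi.one_apply, mul_one]
      rw [Real.norm_of_nonneg (by positivity)]
      gcongr
    · simp only [hφ_def, Set.indicator_of_notMem ht, mul_zero, norm_zero]
      positivity
  have hbdd : ∀ f : (Fin n → ℝ) → ℝ, Integrable f (law n (1 + k) 1) →
      Integrable (fun x => f x * φ (statX x)) (law n (1 + k) 1) :=
    fun f hf => hf.mul_bdd (hφ.comp measurable_statX).aestronglyMeasurable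
      (Filter.Eventually.of_forall fun x => hφb _)
  have hD : ∀ r : ℝ, 0 < r → Integrable (fun x => T x - (1 + k)) (law n (1 + k) r) :=
    fun r hr => by
      have := isProbabilityMeasure_law (n := n) ha hr
      exact (hT.integrable _ _ ha hr).sub (integrable_const _)
  have h := integral_mul_comp_statX_eq_zero hn0 ha hD
    (fun r hr => by
      have := isProbabilityMeasure_law (n := n) ha hr
      rw [integral_sub (hT.integrable _ _ ha hr) (integrable_const _), hT.integral_eq _ _ ha hr]
      simp [shape]) one_pos hφ (hbdd _ (hD 1 one_pos))
  simp only [sub_mul] at h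
  rw [integral_sub (hbdd _ (hT.integrable _ _ ha one_pos)) (hbdd _ (integrable_const _)),
    integral_const_mul, sub_eq_zero] at h
  have htilt : ∀ f : (Fin n → ℝ) → ℝ, ∫ x, f x * φ (statX x) ∂law n (1 + k) 1 =
      tiltConst 1 1 k 0 ^ n * ((n : ℝ) ^ (n * k))⁻¹ *
        ∫ x, f x * (statY x ^ k * (Set.Ici ε).indicator 1 (statX x)) ∂law n 1 1 := by
    intro f
    have h1 := integral_law_tilt (n := n) one_pos one_pos le_rfl k fun x => f x * φ (statX x)
    rw [add_zero] at h1
    rw [h1, mul_assoc, ← integral_const_mul ((n : ℝ) ^ (n * k))⁻¹]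
    congr 1
    refine integral_congr_ae ?_
    filter_upwards [ae_law_pos one_pos one_pos] with x hx
    have hX := (statX_pos hn0 hx).ne'
    have hn' : (n : ℝ) ≠ 0 := by positivity
    simp only [hφ_def]
    rw [statY_eq hn0 hx, div_pow, mul_pow, ← pow_mul, ← pow_mul, zero_mul, neg_zero, Real.exp_zero]
    field_simp
  have hC := tiltConst_pos one_pos one_pos le_rfl k
  have h2 := htilt fun _ => 1
  simp only [one_mul] at h2
  rw [htilt T, h2, mul_left_comm] at h
  exact mul_left_cancel₀ (by positivity) h

theorem not_isUnbiased_of_le_three (hn : n = 2 ∨ n = 3) {T : (Fin n → ℝ) → ℝ} :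
    ¬IsUnbiased n shape T := by
  intro hT
  have hn2 : 2 ≤ n := by lia
  have := isProbabilityMeasure_law (n := n) one_pos one_pos
  obtain ⟨ε, hε, hne⟩ := exists_law_statX_ge_ne_zero (n := n) (by lia) one_pos one_pos
  have hind : Measurable ((Set.Ici ε).indicator (1 : ℝ → ℝ)) :=
    measurable_one.indicator measurableSet_Ici
  set q : ℝ := ∫ x, (Set.Ici ε).indicator 1 (statX x) ∂law n 1 1 with hq
  have hq0 : 0 < q := by
    have e : (fun x : Fin n → ℝ => (Set.Ici ε).indicator (1 : ℝ → ℝ) (statX x)) =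
        {x : Fin n → ℝ | ε ≤ statX x}.indicator 1 := rfl
    rw [hq, e, integral_indicator_one (measurableSet_le measurable_const measurable_statX)]
    exact ENNReal.toReal_pos hne (measure_ne_top _ _)
  -- Almost surely Y < 1, so Y^k → 0, with |T| as dominating function.
  have hlim : Filter.Tendsto (fun k : ℕ =>
      ∫ x, T x * (statY x ^ k * (Set.Ici ε).indicator 1 (statX x)) ∂law n 1 1)
      Filter.atTop (nhds 0) := by
    have hT1 := hT.integrable 1 1 one_pos one_pos
    have hTm := hT.measurable
    have h := tendsto_integral_of_dominated_convergence (μ := law n 1 1)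
      (F := fun (k : ℕ) x => T x * (statY x ^ k * (Set.Ici ε).indicator 1 (statX x)))
      (f := fun _ => 0) (fun x => ‖T x‖)
      (fun k => Measurable.aestronglyMeasurable (by fun_prop)) hT1.norm
      (fun k => ?_) ?_
    · simpa using h
    · filter_upwards [ae_statY_mem_Ioo hn2 one_pos one_pos] with x hx
      rw [norm_mul, norm_mul, norm_pow, Real.norm_of_nonneg hx.1.le]
      refine mul_le_of_le_one_right (norm_nonneg _) (mul_le_one₀ (pow_le_one₀ hx.1.le hx.2.le)
        (norm_nonneg _) ((norm_indicator_le_norm_self _ _).trans (by simp)))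
    · filter_upwards [ae_statY_mem_Ioo hn2 one_pos one_pos] with x hx
      have := ((tendsto_pow_atTop_nhds_zero_of_lt_one hx.1.le hx.2).mul_const
        ((Set.Ici ε).indicator (1 : ℝ → ℝ) (statX x))).const_mul (T x)
      simpa using this
  have hge : ∀ k : ℕ, 2 / 3 * q ≤
      ∫ x, T x * (statY x ^ k * (Set.Ici ε).indicator 1 (statX x)) ∂law n 1 1 := by
    intro k
    rw [hT.integral_mul_statY_pow hn2 hε, integral_statY_pow_mul_indicator hn2, ← hq, ← mul_assoc]
    exact mul_le_mul_of_nonneg_right (le_succ_mul_momentY hn k) hq0.le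
  have := ge_of_tendsto' hlim hge
  linarith

end GammaSample

end

theorem theorem1 (n : ℕ) (hn : 2 ≤ n) :
    -- the UMVUE of the shape exists exactly when `n ≥ 4`
    ((∃ T : (Fin n → ℝ) → ℝ, GammaSample.IsUMVUE n GammaSample.shape T) ↔ 4 ≤ n) ∧
    (4 ≤ n →
      -- the power series converges on `(0, 1)`, to a positive differentiable function
      (∀ y ∈ Set.Ioo (0 : ℝ) 1,
        Summable (fun m : ℕ => GammaSample.d n m * (1 - y) ^ m) ∧
        DifferentiableAt ℝ (GammaSample.G n) y ∧ 0 < GammaSample.G n y) ∧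
      -- `u₀(Y)` is a UMVUE
      GammaSample.IsUMVUE n GammaSample.shape
        (fun x => GammaSample.u₀ n (GammaSample.statY x)) ∧
      -- it is the only one, up to almost sure equality
      (∀ T : (Fin n → ℝ) → ℝ, GammaSample.IsUMVUE n GammaSample.shape T →
        ∀ α r : ℝ, 0 < α → 0 < r →
          T =ᵐ[GammaSample.law n α r] fun x => GammaSample.u₀ n (GammaSample.statY x)) ∧
      -- its variance is minimal among all unbiased estimators, at every parameter
      (∀ T : (Fin n → ℝ) → ℝ, GammaSample.IsUnbiased n GammaSample.shape T →
        ∀ α r : ℝ, 0 < α → 0 < r →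
          evariance (fun x => GammaSample.u₀ n (GammaSample.statY x)) (GammaSample.law n α r) ≤
            evariance T (GammaSample.law n α r)) ∧
      -- its variance is finite exactly when `n ≥ 6`
      (∀ α r : ℝ, 0 < α → 0 < r →
        (evariance (fun x => GammaSample.u₀ n (GammaSample.statY x))
          (GammaSample.law n α r) < ⊤ ↔ 6 ≤ n))) ∧
    -- for `n = 2, 3` there is no unbiased estimator
    (n = 2 ∨ n = 3 → ¬ ∃ T : (Fin n → ℝ) → ℝ, GammaSample.IsUnbiased n GammaSample.shape T) := by
  have hn0 : 0 < n := by lia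
  have hno : n = 2 ∨ n = 3 →
      ¬∃ T : (Fin n → ℝ) → ℝ, GammaSample.IsUnbiased n GammaSample.shape T :=
    fun h ⟨_, hT⟩ => GammaSample.not_isUnbiased_of_le_three h hT
  refine ⟨⟨fun ⟨T, hT⟩ => ?_, fun h => ⟨_, GammaSample.isUMVUE_u₀ h⟩⟩, fun h4 => ⟨fun y hy => ?_,
    GammaSample.isUMVUE_u₀ h4, fun T hT a r ha hr => ?_, fun T hT a r ha hr => ?_,
    fun a r ha hr => ?_⟩, hno⟩
  · by_contra h
    exact hno (by lia) ⟨T, hT.unbiased⟩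
  · exact ⟨GammaSample.summable_d_mul_pow hn hy,
      (GammaSample.hasDerivAt_G hn hy).differentiableAt, GammaSample.G_pos hn hy⟩
  · exact (GammaSample.isUMVUE_u₀ h4).ae_eq hn0 hT ha hr
  · exact (GammaSample.isUMVUE_u₀ h4).evariance_le hn0 hT ha hr
  · refine ⟨fun h => ?_, fun h6 => GammaSample.evariance_u₀_lt_top h6 ha hr⟩
    by_contra h6
    exact GammaSample.evariance_u₀_eq_top h4 (by lia) ha hr h
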